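/- Let $n>1$ and let $P(z)\in\mathbb C[z]$ be a monic polynomial of degree $n$. Let $B_P=\{P(z)\mid P'(z)=0\}\subset\mathbb C$ be its branch locus (the set of critical values), let $w_0\in\mathbb C\setminus B_P$, and let $K=P^{-1}(w_0)$, a set of $n$ points. Let $\mathrm{Br}_n=\mathrm{Br}_n[\mathbb C,K]$ be the geometric braid group of the plane: its elements are the families $b=(b_q)_{q\in K}$ of continuous paths $b_q:[0,1]\to\mathbb C$ with $b_q(0)=q$, $b_q(1)\in K$ and $b_q(t)\neq b_{q'}(t)$ for all $t$ and all $q\neq q'$, up to isotopy (continuous deformation through such families with fixed end points), and the product $bc$ is $b$ followed by $c$. For a loop $\lambda$ in $\mathbb C\setminus B_P$ based at $w_0$, the lifts of $\lambda$ along $z\mapsto P(z)$ starting at the points of $K$ form a geometric braid $b(\lambda)=P^{-1}(\lambda)$, and $[\lambda]\mapsto[b(\lambda)]$ is a well-defined homomorphism $\beta_P:\pi_1(\mathbb C\setminus B_P,w_0)\to\mathrm{Br}_n[\mathbb C,K]$, the braid monodromy homomorphism (where products of loops are also read from left to right). Its image $\Gamma_P$ is called the braid monodromy group of $P$. **Theorem.**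 If $B_P$ consists of $n-1$ distinct points, then, for every $w_0\in\mathbb C\setminus B_P$, the homomorphism $\beta_P$ is surjective, that is, $\Gamma_P=\mathrm{Br}_n[\mathbb C,K]$. -/

import Mathlib

open scoped Polynomial

noncomputable section

namespace BraidMonodromy

/-! ### Geometric braid groups of the plane -/

/-- Injective labellings `K → ℂ`, i.e. families of pairwise distinct points of the plane indexed
by `K`, with the topology of pointwise convergence. A path in this space is a family of strands
`b_q : [0,1] → ℂ`, `q ∈ K`, whose graphs in `ℂ × [0,1]` are pairwise disjoint. -/
abbrev Conf (K : Set ℂ) : Type := {f : K → ℂ // Function.Injective f}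

/-- The labelling `q ↦ σ q` of the points of `K` by themselves. -/
def pt {K : Set ℂ} (σ : Equiv.Perm K) : Conf K :=
  ⟨fun q => (σ q : ℂ), Subtype.val_injective.comp σ.injective⟩

/-- Relabelling of the strands: the strand labelled `q` becomes the one that was labelled
`τ q`. -/
def reindex {K : Set ℂ} (τ : Equiv.Perm K) : C(Conf K, Conf K) where
  toFun f := ⟨fun q => f.1 (τ q), f.2.comp τ.injective⟩
  continuous_toFun := by
    refine Continuous.subtype_mk (continuous_pi fun q => ?_) _
    exact (continuous_apply (τ q)).comp continuous_subtype_val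

/-- The geometric braid group `Br[ℂ, K]` of the plane, with strings starting and ending in the
(finite) set `K`. An element is the isotopy class of a geometric braid `(b_q)_{q ∈ K}`, that is,
of a family of paths that are pairwise distinct at each time `t ∈ [0,1]`, with `b_q 0 = q` and
`b_q 1 = σ q ∈ K`. An isotopy is a continuous family of geometric braids, i.e. a homotopy with
fixed end points of the path `t ↦ (q ↦ b_q t)` in `Conf K`. -/
structure BraidGroup (K : Set ℂ) : Type where
  /-- the permutation of `K` that maps the start point of each strand to its end point -/
  perm : Equiv.Perm K
  /-- the isotopy class of the strands -/
  strands : Path.Homotopic.Quotient (pt (1 : Equiv.Perm K)) (pt perm)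

namespace BraidGroup

variable {K : Set ℂ}

/-- The isotopy class of a geometric braid. -/
def mk' (σ : Equiv.Perm K) (b : Path (pt (1 : Equiv.Perm K)) (pt σ)) : BraidGroup K :=
  ⟨σ, Path.Homotopic.Quotient.mk b⟩

theorem ind' {motive : BraidGroup K → Prop} (h : ∀ σ b, motive (mk' σ b)) (x : BraidGroup K) :
    motive x := by
  obtain ⟨σ, b⟩ := x
  obtain ⟨b, rfl⟩ := Path.Homotopic.Quotient.mk_surjective b
  exact h σ b

theorem mk'_eq {σ τ : Equiv.Perm K} {b : Path (pt (1 : Equiv.Perm K)) (pt σ)}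
    {c : Path (pt (1 : Equiv.Perm K)) (pt τ)} (h : σ = τ)
    (hbc : b.Homotopic (c.cast rfl (congrArg pt h))) : mk' σ b = mk' τ c := by
  subst h
  simp only [mk']
  congr 1
  exact Path.Homotopic.Quotient.eq.2 hbc

/-- Composition of geometric braids: at times `t ≤ 1/2` the strand starting at `q` is
`b_q (2 t)`, at times `t ≥ 1/2` it is `c_{σ q} (2 t - 1)`, where `σ` is the permutation of
the braid `b`. -/
def comp {σ τ : Equiv.Perm K} (b : Path (pt (1 : Equiv.Perm K)) (pt σ))
    (c : Path (pt (1 : Equiv.Perm K)) (pt τ)) : Path (pt (1 : Equiv.Perm K)) (pt (τ * σ)) :=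
  b.trans (c.map (reindex σ).continuous)

/-- The product `b * c` is the braid `b` followed by the braid `c`. -/
instance : Mul (BraidGroup K) where
  mul b c := ⟨c.perm * b.perm, b.strands.trans (c.strands.map (reindex b.perm))⟩

instance : One (BraidGroup K) where
  one := mk' 1 (Path.refl _)

/-- The strands of the inverse braid are the given strands run backwards. -/
def inv' {σ : Equiv.Perm K} (b : Path (pt (1 : Equiv.Perm K)) (pt σ)) :
    Path (pt (1 : Equiv.Perm K)) (pt σ⁻¹) :=
  ((b.map (reindex σ⁻¹).continuous).symm).cast
    (Subtype.ext (funext fun q => by simp [pt, reindex])) rfl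

instance : Inv (BraidGroup K) where
  inv b := ⟨b.perm⁻¹, ((b.strands.map (reindex b.perm⁻¹)).symm).cast
    (Subtype.ext (funext fun q => by simp [pt, reindex])) rfl⟩

theorem mk'_mul {σ τ : Equiv.Perm K} (b : Path (pt (1 : Equiv.Perm K)) (pt σ))
    (c : Path (pt (1 : Equiv.Perm K)) (pt τ)) :
    mk' σ b * mk' τ c = mk' (τ * σ) (comp b c) := rfl

theorem one_def : (1 : BraidGroup K) = mk' 1 (Path.refl _) := rfl

theorem mk'_inv {σ : Equiv.Perm K} (b : Path (pt (1 : Equiv.Perm K)) (pt σ)) :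
    (mk' σ b)⁻¹ = mk' σ⁻¹ (inv' b) := rfl

theorem symm_cast_trans {X : Type*} [TopologicalSpace X] {x y z : X} (p : Path x y) (h : z = y)
    (h' : y = z) : ((p.symm.cast h rfl).trans p).Homotopic ((Path.refl z).cast rfl h') := by
  subst h
  exact Path.Homotopic.symm_trans p

instance : Group (BraidGroup K) where
  mul_assoc x y z := by
    induction x using ind' with | h σ a
    induction y using ind' with | h τ b
    induction z using ind' with | h ρ c
    simp only [mk'_mul]
    refine mk'_eq (mul_assoc _ _ _).symm ?_
    have h := Path.Homotopic.trans_assoc a (b.map (reindex σ).continuous)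
      ((c.map (reindex τ).continuous).map (reindex σ).continuous)
    have e : (comp b c).map (reindex σ).continuous = (b.map (reindex σ).continuous).trans
        ((c.map (reindex τ).continuous).map (reindex σ).continuous) :=
      Path.map_trans b (c.map (reindex τ).continuous) (reindex σ).continuous
    change (comp (comp a b) c).Homotopic (a.trans ((comp b c).map (reindex σ).continuous))
    rw [e]
    exact h
  one_mul x := by
    induction x using ind' with | h σ a
    simp only [mk'_mul, one_def]
    exact mk'_eq (mul_one _) (Path.Homotopic.refl_trans a)
  mul_one x := by
    induction x using ind' with | h σ a
    simp only [mk'_mul, one_def]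
    exact mk'_eq (one_mul _) (Path.Homotopic.trans_refl a)
  inv_mul_cancel x := by
    induction x using ind' with | h σ a
    simp only [mk'_mul, mk'_inv, one_def]
    refine mk'_eq (mul_inv_cancel σ) ?_
    exact symm_cast_trans (a.map (reindex σ⁻¹).continuous) _ _

end BraidGroup

/-! ### Braid monodromy of a polynomial -/

/-- The branch locus of `z ↦ P z`: the set of critical values of `P`. -/
def branchLocus (P : ℂ[X]) : Set ℂ := P.eval '' {z | P.derivative.eval z = 0}

/-- The fibre `P⁻¹(w₀)`. -/
def fiber (P : ℂ[X]) (w₀ : ℂ) : Set ℂ := {z | P.eval z = w₀}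

/-- The restriction `ℂ ∖ P⁻¹(B) → ℂ ∖ B` of `z ↦ P z`, where `B` is the branch locus. -/
def cover (P : ℂ[X]) : P.eval ⁻¹' (branchLocus P)ᶜ → ((branchLocus P)ᶜ : Set ℂ) :=
  (branchLocus P)ᶜ.restrictPreimage P.eval

theorem isCoveringMap_cover (P : ℂ[X]) : IsCoveringMap (cover P) :=
  P.isCoveringMapOn_eval.isCoveringMap_restrictPreimage

section

variable (P : ℂ[X]) (w₀ : ((branchLocus P)ᶜ : Set ℂ))

/-- A point of `P⁻¹(w₀)` as a point of the covering space. -/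
def toCover (q : fiber P w₀) : P.eval ⁻¹' (branchLocus P)ᶜ :=
  ⟨q.1, by
    have h : P.eval q.1 = w₀ := q.2
    rw [Set.mem_preimage, h]
    exact w₀.2⟩

theorem cover_toCover (q : fiber P w₀) : cover P (toCover P w₀ q) = w₀ := Subtype.ext q.2

/-- The identification of `P⁻¹(w₀)` with the fibre over `w₀` of the covering. -/
def fiberEquiv : fiber P w₀ ≃ cover P ⁻¹' {w₀} where
  toFun q := ⟨toCover P w₀ q, cover_toCover P w₀ q⟩
  invFun e := ⟨e.1.1, congrArg Subtype.val e.2⟩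
  left_inv _ := rfl
  right_inv _ := rfl

variable {P w₀}

/-- The strand that starts at `q ∈ P⁻¹(w₀)` of the braid `b(γ)`: the unique lift of the loop `γ`
along `z ↦ P z` with starting point `q`. -/
def strand (γ : Path w₀ w₀) (q : fiber P w₀) :
    C(unitInterval, P.eval ⁻¹' (branchLocus P)ᶜ) :=
  (isCoveringMap_cover P).liftPath γ (toCover P w₀ q)
    (γ.source.trans (cover_toCover P w₀ q).symm)

theorem cover_strand (γ : Path w₀ w₀) (q : fiber P w₀) (t : unitInterval) :
    cover P (strand γ q t) = γ t :=
  congrFun ((isCoveringMap_cover P).liftPath_lifts γ (toCover P w₀ q) _) t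

theorem eval_strand (γ : Path w₀ w₀) (q : fiber P w₀) (t : unitInterval) :
    P.eval (strand γ q t : ℂ) = γ t :=
  congrArg Subtype.val (cover_strand γ q t)

theorem strand_zero (γ : Path w₀ w₀) (q : fiber P w₀) : strand γ q 0 = toCover P w₀ q :=
  (isCoveringMap_cover P).liftPath_zero γ (toCover P w₀ q) _

theorem eq_strand {γ : Path w₀ w₀} {q : fiber P w₀}
    (Γ : C(unitInterval, P.eval ⁻¹' (branchLocus P)ᶜ)) (h : ∀ t, cover P (Γ t) = γ t)
    (h0 : Γ 0 = toCover P w₀ q) : Γ = strand γ q :=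
  ((isCoveringMap_cover P).eq_liftPath_iff' _).2 ⟨funext h, h0⟩

theorem homotopic_of_eq {X : Type*} [TopologicalSpace X] {x y : X} {b c : Path x y} (h : b = c) :
    b.Homotopic c := h ▸ .refl b

/-- A family of lifts of one map, with different values at one point, has pairwise distinct
values everywhere. -/
theorem injective_lifts {A : Type*} [TopologicalSpace A] [PreconnectedSpace A]
    (G : fiber P w₀ → C(A, P.eval ⁻¹' (branchLocus P)ᶜ)) {g : A → ((branchLocus P)ᶜ : Set ℂ)}
    (hg : ∀ q a, cover P (G q a) = g a) (a₀ : A) (h₀ : ∀ q, G q a₀ = toCover P w₀ q) (a : A) :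
    Function.Injective fun q => (G q a : ℂ) := by
  intro q q' h
  have h1 : (G q : A → _) = G q' :=
    (isCoveringMap_cover P).eq_of_comp_eq (G q).continuous (G q').continuous
      (funext fun a => (hg q a).trans (hg q' a).symm) a (Subtype.ext h)
  have h2 : toCover P w₀ q = toCover P w₀ q' := by rw [← h₀, ← h₀, h1]
  exact Subtype.ext (congrArg (fun e : P.eval ⁻¹' (branchLocus P)ᶜ => (e : ℂ)) h2)

/-- The permutation of `P⁻¹(w₀)` induced by a loop: it maps the starting point of each lift to
its end point. -/
def liftPerm (γ : Path.Homotopic.Quotient w₀ w₀) : Equiv.Perm (fiber P w₀) :=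
  (fiberEquiv P w₀).symm.permCongr ((isCoveringMap_cover P).monodromyPerm w₀ γ)

theorem liftPerm_mk (γ : Path w₀ w₀) (q : fiber P w₀) :
    (liftPerm (.mk γ) q : ℂ) = strand γ q 1 := rfl

/-- The geometric braid `b(γ) = P⁻¹(γ)`, whose strands are the lifts of the loop `γ`. -/
def liftBraid (γ : Path w₀ w₀) :
    Path (pt (1 : Equiv.Perm (fiber P w₀))) (pt (liftPerm (.mk γ))) where
  toFun t := ⟨fun q => strand γ q t,
    injective_lifts (strand γ) (cover_strand γ) 0 (strand_zero γ) t⟩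
  continuous_toFun := Continuous.subtype_mk
    (continuous_pi fun q => continuous_subtype_val.comp (strand γ q).continuous) _
  source' := Subtype.ext (funext fun q => congrArg Subtype.val (strand_zero γ q))
  target' := rfl

theorem mk'_liftBraid_eq {γ γ' : Path w₀ w₀} (h : γ.Homotopic γ') :
    BraidGroup.mk' (liftPerm (.mk γ)) (liftBraid γ) =
      BraidGroup.mk' (liftPerm (.mk γ')) (liftBraid γ') := by
  obtain ⟨F⟩ := h
  have hσ : liftPerm (P := P) (.mk γ) = liftPerm (.mk γ') :=
    congrArg liftPerm (Path.Homotopic.Quotient.eq.2 ⟨F⟩)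
  refine BraidGroup.mk'_eq hσ ?_
  have hl (γ : Path w₀ w₀) (q : fiber P w₀) : cover P ∘ strand γ q = γ.toContinuousMap :=
    funext fun t => cover_strand γ q t
  have hF (q : fiber P w₀) (t : unitInterval) :
      F.toContinuousMap (0, t) = cover P (strand γ q t) :=
    (F.apply_zero t).trans (cover_strand γ q t).symm
  let H (q : fiber P w₀) : (strand γ q).HomotopyRel (strand γ' q) {0, 1} :=
    (isCoveringMap_cover P).liftHomotopyRel F ⟨0, .inl rfl, by simp only [strand_zero]⟩
      (hl γ q) (hl γ' q)
  have hH (q : fiber P w₀) (x : unitInterval × unitInterval) : cover P (H q x) = F x :=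
    congrFun ((isCoveringMap_cover P).liftHomotopy_lifts F.toContinuousMap (strand γ q) (hF q)) x
  have hH0 (q : fiber P w₀) : H q (0, 0) = toCover P w₀ q := by
    rw [(H q).apply_zero, strand_zero]
  refine ⟨{
    toFun := fun x => ⟨fun q => (H q x : ℂ),
      injective_lifts (fun q => (H q).toContinuousMap) hH (0, 0) hH0 x⟩
    continuous_toFun := Continuous.subtype_mk
      (continuous_pi fun q => continuous_subtype_val.comp (H q).continuous) _
    map_zero_left := fun t => Subtype.ext (funext fun q =>
      congrArg Subtype.val ((H q).apply_zero t))
    map_one_left := fun t => Subtype.ext (funext fun q =>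
      congrArg Subtype.val ((H q).apply_one t))
    prop' := fun s t ht => Subtype.ext (funext fun q =>
      congrArg Subtype.val ((H q).eq_fst s ht)) }⟩

/-- The class of the braid `b(γ)`, as a function of the homotopy class of the loop `γ`. -/
def braidOfClass (γ : Path.Homotopic.Quotient w₀ w₀) :
    BraidGroup (fiber P w₀) :=
  Quotient.lift (s := Path.Homotopic.setoid w₀ w₀)
    (fun γ : Path w₀ w₀ => BraidGroup.mk' (liftPerm (.mk γ)) (liftBraid γ))
    (fun _ _ h => mk'_liftBraid_eq h) γ

theorem braidOfClass_mk (γ : Path w₀ w₀) :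
    braidOfClass (.mk γ) = BraidGroup.mk' (liftPerm (.mk γ)) (liftBraid γ) := rfl

theorem braidOfClass_refl : braidOfClass (.refl w₀) = (1 : BraidGroup (fiber P w₀)) := by
  have hs (q : fiber P w₀) : strand (Path.refl w₀) q = .const _ (toCover P w₀ q) :=
    (eq_strand _ (fun _ => cover_toCover P w₀ q) rfl).symm
  rw [← Path.Homotopic.Quotient.mk_refl, braidOfClass_mk, BraidGroup.one_def]
  refine BraidGroup.mk'_eq (Equiv.ext fun q => Subtype.ext ?_) ?_
  · rw [liftPerm_mk, hs]
    rfl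
  · refine homotopic_of_eq (Path.ext (funext fun t => Subtype.ext (funext fun q => ?_)))
    exact congrArg Subtype.val (DFunLike.congr_fun (hs q) t)

theorem strand_trans (γ γ' : Path w₀ w₀) (q : fiber P w₀) (t : unitInterval) :
    (strand (γ.trans γ') q t : ℂ) =
      ((BraidGroup.comp (liftBraid γ) (liftBraid γ')) t).1 q := by
  have h := DFunLike.congr_fun ((isCoveringMap_cover P).liftPath_trans
    (cover_toCover P w₀ q).symm γ γ') t
  have h2 := h.trans (Path.trans_apply _ _ t)
  have h3 := Path.trans_apply (liftBraid (P := P) γ)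
    ((liftBraid γ').map (reindex (liftPerm (.mk γ))).continuous) t
  refine (congrArg Subtype.val h2).trans (Eq.trans ?_
    (congrFun (congrArg Subtype.val h3) q).symm)
  split_ifs <;> rfl

theorem braidOfClass_trans (γ γ' : Path.Homotopic.Quotient w₀ w₀) :
    braidOfClass (γ.trans γ') = (braidOfClass γ * braidOfClass γ' : BraidGroup (fiber P w₀)) := by
  induction γ with | mk γ
  induction γ' with | mk γ'
  rw [← Path.Homotopic.Quotient.mk_trans]
  simp only [braidOfClass_mk, BraidGroup.mk'_mul]
  refine BraidGroup.mk'_eq (Equiv.ext fun q => Subtype.ext ?_) ?_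
  · rw [liftPerm_mk, strand_trans, Path.target]
    rfl
  · exact homotopic_of_eq (Path.ext (funext fun t => Subtype.ext (funext fun q => strand_trans γ γ' q t)))

end

/-- The braid monodromy homomorphism `π₁(ℂ ∖ B, w₀) → Br[ℂ, P⁻¹(w₀)]`, which maps the class of a
loop `γ` to the class of the braid `b(γ) = P⁻¹(γ)`. In the fundamental group of Mathlib the
product `x * y` is the loop `y` followed by the loop `x`; in the braid group above, `b * c`
is `b` followed by `c`. Hence the opposite group on the left, in which the product of loops is
their concatenation from left to right. -/
def braidMonodromy (P : ℂ[X]) (w₀ : ((branchLocus P)ᶜ : Set ℂ)) :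
    (FundamentalGroup ((branchLocus P)ᶜ : Set ℂ) w₀)ᵐᵒᵖ →* BraidGroup (fiber P w₀) where
  toFun γ := braidOfClass γ.unop
  map_one' := braidOfClass_refl
  map_mul' γ γ' := braidOfClass_trans γ.unop γ'.unop

/-- The braid monodromy group `Γ_P`: the image of the braid monodromy homomorphism. -/
def braidMonodromyGroup (P : ℂ[X]) (w₀ : ((branchLocus P)ᶜ : Set ℂ)) :
    Subgroup (BraidGroup (fiber P w₀)) :=
  (braidMonodromy P w₀).range

/-- Outside the branch locus a fibre has `deg P` points, so that the braids above have `deg P`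
strings. -/
theorem ncard_fiber (P : ℂ[X]) (hP : 0 < P.natDegree) {w₀ : ℂ} (hw₀ : w₀ ∉ branchLocus P) :
    (fiber P w₀).ncard = P.natDegree := by
  have hd : (P - Polynomial.C w₀).natDegree = P.natDegree := Polynomial.natDegree_sub_C
  have h0 : P - Polynomial.C w₀ ≠ 0 := by
    intro h
    rw [h, Polynomial.natDegree_zero] at hd
    omega
  have hs : fiber P w₀ = ((P - Polynomial.C w₀).roots.toFinset : Set ℂ) := by
    ext z
    simp [fiber, h0, sub_eq_zero]
  have hn : (P - Polynomial.C w₀).roots.Nodup := by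
    rw [Multiset.nodup_iff_count_le_one]
    intro z
    rw [Polynomial.count_roots]
    by_contra! hz
    obtain ⟨h1, h2⟩ := (Polynomial.one_lt_rootMultiplicity_iff_isRoot h0).1 hz
    refine hw₀ ⟨z, ?_, ?_⟩
    · simpa using h2
    · simpa [sub_eq_zero] using h1
  rw [hs, Set.ncard_coe_finset, Multiset.toFinset_card_of_nodup hn, ← hd]
  exact (IsAlgClosed.splits _).natDegree_eq_card_roots.symm

end BraidMonodromy

end

set_option linter.unusedSectionVars false

open unitInterval Topology Polynomial

noncomputable section

namespace BraidMonodromy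

open Path.Homotopic (Quotient)

/-! ### Paths in an open subset of a product -/

/-! Let p_a be the monic polynomial of degree m + 1 with lower coefficients a, and let `regular m`
be the space of pairs (a, w) with w not a critical value of p_a. The pairs (a, z) with p_a(z) = w
form a covering of it (`isCoveringMap_rootCover`). A geometric braid b on P⁻¹(w₀) gives a loop in
`regular m` at the constant height w₀, with polynomial ∏ (X - b_q(t)) + w₀ at time t, and the
strands of b are lifts of this loop. If the loop is homotopic to a loop γ inside the fibre ℂ ∖ B_P
over P, then lifting the homotopy to the covering gives an isotopy between b and b(γ)
(`mk'_eq_of_labelLoop_homotopic`). So it suffices that the fibre over P carries all of π₁(`regular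
m`), which is `exists_vert_eq_of_ncard`.

The projection (a, w) ↦ a is not a fibration, because critical values may collide. Two facts make up
for this. Over a ball of coefficients there is a height M beyond all critical values; this is a
section over a convex base, so the class of a horizontal path at height M depends only on its end
points. Moreover, every loop at height M in the fibre over a can be carried to the fibre over P
(`absorbs_of_ncard`): since P has m distinct critical values, some curve from a to P has distinct
critical values except possibly at its start. The loop survives the first instant because `regular
m` is open, and from then on the fibres are complements of distinct moving points, hence locally
trivial (`absorbs_of_injective`).

Any loop is now cut into short pieces, each of them rewritten as vertical, horizontal, vertical, and
the intermediate vertical loops are pushed back to the fibre over P (`isNormal_subpath`). What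
remains horizontally is a loop in a convex set, hence trivial (`exists_vert_eq`). -/

/-- Two paths in `O` with the same end points are homotopic if they lie in a convex subset. -/
theorem homotopic_of_convex {E : Type*} [AddCommGroup E] [Module ℝ E] [TopologicalSpace E]
    [IsTopologicalAddGroup E] [ContinuousSMul ℝ E] {O S : Set E} (hS : Convex ℝ S) (hSO : S ⊆ O)
    {x y : O} (p q : Path x y) (hp : ∀ t, (p t : E) ∈ S) (hq : ∀ t, (q t : E) ∈ S) :
    p.Homotopic q := by
  have hmem (s t : I) : (1 - (s : ℝ)) • (p t : E) + (s : ℝ) • (q t : E) ∈ S :=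
    hS (hp t) (hq t) (by linarith [s.2.2]) s.2.1 (by ring)
  refine ⟨{
    toFun := fun x => ⟨(1 - (x.1 : ℝ)) • (p x.2 : E) + (x.1 : ℝ) • (q x.2 : E), hSO (hmem _ _)⟩
    continuous_toFun := by fun_prop
    map_zero_left := fun t => Subtype.ext (by simp)
    map_one_left := fun t => Subtype.ext (by simp)
    prop' := ?_ }⟩
  rintro s t (rfl | rfl) <;> refine Subtype.ext ?_ <;> simp [← add_smul]

section

variable {V : Type*} [TopologicalSpace V] {O : Set (V × ℂ)}
  {a b c : V} {u v w : ℂ}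

/-- The path `t ↦ (γ t, l t)` in `O`. -/
def pairPath (γ : Path a b) (l : Path u v) (h : ∀ t, (γ t, l t) ∈ O) :
    Path (⟨(a, u), by simpa using h 0⟩ : O) ⟨(b, v), by simpa using h 1⟩ where
  toFun t := ⟨(γ t, l t), h t⟩
  continuous_toFun := by fun_prop
  source' := by simp
  target' := by simp

theorem pairPath_trans (γ : Path a b) (l : Path u v) (h : ∀ t, (γ t, l t) ∈ O)
    (γ' : Path b c) (l' : Path v w) (h' : ∀ t, (γ' t, l' t) ∈ O) :
    ∃ h'' : ∀ t, (γ.trans γ' t, l.trans l' t) ∈ O,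
    (pairPath γ l h).trans (pairPath γ' l' h') = pairPath (γ.trans γ') (l.trans l') h'' := by
  have key (t : I) : (((pairPath γ l h).trans (pairPath γ' l' h') t : O) : V × ℂ) =
      (γ.trans γ' t, l.trans l' t) := by
    simp only [Path.trans_apply]
    split_ifs <;> rfl
  exact ⟨fun t => key t ▸ Subtype.prop _, Path.ext (funext fun t => Subtype.ext (key t))⟩

/-- The class of a path in a fibre of `O`. -/
def vert (a : V) (l : Path u v) (h : ∀ t, (a, l t) ∈ O) :
    Quotient (⟨(a, u), by simpa using h 0⟩ : O) ⟨(a, v), by simpa using h 1⟩ :=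
  .mk (pairPath (.refl a) l h)

/-- The class of a path in `O` with constant second coordinate. -/
def horiz (γ : Path a b) (w : ℂ) (h : ∀ t, (γ t, w) ∈ O) :
    Quotient (⟨(a, w), by simpa using h 0⟩ : O) ⟨(b, w), by simpa using h 1⟩ :=
  .mk (pairPath γ (.refl w) h)

theorem trans_mem {X : Type*} [TopologicalSpace X] {x y z : X} {l : Path x y} {l' : Path y z}
    {s : Set X} (h : ∀ t, l t ∈ s)
    (h' : ∀ t, l' t ∈ s) (t : I) : l.trans l' t ∈ s := by
  rw [Path.trans_apply]
  split_ifs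
  exacts [h _, h' _]

theorem vert_trans_mem {l : Path u v} (h : ∀ t, (a, l t) ∈ O) {l' : Path v w}
    (h' : ∀ t, (a, l' t) ∈ O) (t : I) : (a, l.trans l' t) ∈ O :=
  trans_mem (s := {z | (a, z) ∈ O}) h h' t

theorem vert_trans (l : Path u v) (h : ∀ t, (a, l t) ∈ O) (l' : Path v w)
    (h' : ∀ t, (a, l' t) ∈ O) :
    vert a (l.trans l') (vert_trans_mem h h') = (vert a l h).trans (vert a l' h') := by
  obtain ⟨h'', e⟩ := pairPath_trans (.refl a) l h (.refl a) l' h'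
  rw [vert, vert, vert, ← Path.Homotopic.Quotient.mk_trans, e]
  exact congrArg _ (Path.ext (funext fun t => Subtype.ext (Prod.ext
    (DFunLike.congr_fun Path.refl_trans_refl t).symm rfl)))

theorem horiz_trans_mem {γ : Path a b} (h : ∀ t, (γ t, w) ∈ O) {γ' : Path b c}
    (h' : ∀ t, (γ' t, w) ∈ O) (t : I) : (γ.trans γ' t, w) ∈ O := by
  rw [Path.trans_apply]
  split_ifs
  exacts [h _, h' _]

theorem horiz_trans (γ : Path a b) (h : ∀ t, (γ t, w) ∈ O) (γ' : Path b c)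
    (h' : ∀ t, (γ' t, w) ∈ O) :
    horiz (γ.trans γ') w (horiz_trans_mem h h') = (horiz γ w h).trans (horiz γ' w h') := by
  obtain ⟨h'', e⟩ := pairPath_trans γ (.refl w) h γ' (.refl w) h'
  rw [horiz, horiz, horiz, ← Path.Homotopic.Quotient.mk_trans, e]
  exact congrArg _ (Path.ext (funext fun t => Subtype.ext (Prod.ext rfl
    (DFunLike.congr_fun Path.refl_trans_refl t).symm)))

theorem vert_symm_mem {l : Path u v} (h : ∀ t, (a, l t) ∈ O) (t : I) : (a, l.symm t) ∈ O := h _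

theorem vert_trans_symm (l : Path u v) (h : ∀ t, (a, l t) ∈ O) :
    (vert a l h).trans (vert a l.symm (vert_symm_mem h)) = .refl _ :=
  Path.Homotopic.Quotient.trans_symm (vert a l h)

theorem vert_eq_of_homotopy {l l' : Path u v} (h : ∀ t, (a, l t) ∈ O) (h' : ∀ t, (a, l' t) ∈ O)
    (F : l.Homotopy l') (hF : ∀ x, (a, F x) ∈ O) : vert a l h = vert a l' h' := by
  refine Path.Homotopic.Quotient.eq.2 ⟨{
    toFun := fun x => ⟨(a, F x), hF x⟩
    continuous_toFun := by fun_prop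
    map_zero_left := fun t => Subtype.ext (Prod.ext rfl (F.apply_zero t))
    map_one_left := fun t => Subtype.ext (Prod.ext rfl (F.apply_one t))
    prop' := fun s t ht => Subtype.ext (Prod.ext rfl (F.eq_fst s ht)) }⟩

theorem horiz_eq_of_convex {V : Type*} [AddCommGroup V] [Module ℝ V] [TopologicalSpace V]
    [IsTopologicalAddGroup V] [ContinuousSMul ℝ V] {O : Set (V × ℂ)} {a b : V} {w : ℂ} {S : Set V}
    (hS : Convex ℝ S) (hSO : ∀ a ∈ S, (a, w) ∈ O)
    (γ γ' : Path a b) (h : ∀ t, γ t ∈ S) (h' : ∀ t, γ' t ∈ S) :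
    horiz γ w (fun t => hSO _ (h t)) = horiz γ' w (fun t => hSO _ (h' t)) := by
  refine Path.Homotopic.Quotient.eq.2
    (homotopic_of_convex (hS.prod (convex_singleton w)) ?_ _ _ ?_ ?_)
  · rintro ⟨a, w'⟩ ⟨ha, rfl⟩
    exact hSO a ha
  · exact fun t => ⟨h t, rfl⟩
  · exact fun t => ⟨h' t, rfl⟩

/-- Going around a square in `O`. -/
theorem horiz_trans_vert (γ : Path a b) (l : Path u v) (h : ∀ s t, (γ s, l t) ∈ O)
    (h₁ : ∀ t, (γ t, u) ∈ O) (h₂ : ∀ t, (b, l t) ∈ O) (h₃ : ∀ t, (a, l t) ∈ O)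
    (h₄ : ∀ t, (γ t, v) ∈ O) :
    (horiz γ u h₁).trans (vert b l h₂) = (vert a l h₃).trans (horiz γ v h₄) := by
  let f : C(I × I, O) := ⟨fun x => ⟨(γ x.1, l x.2), h _ _⟩, by fun_prop⟩
  let e : Path (0 : I) 1 := ⟨⟨id, continuous_id⟩, rfl, rfl⟩
  -- The two ways around the boundary of the square I × I are homotopic because the square is simply
  -- connected; `f` carries this homotopy to `O`.
  have : ContractibleSpace I := (convex_Icc (0 : ℝ) 1).contractibleSpace ⟨0, by simp⟩
  have H := SimplyConnectedSpace.paths_homotopic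
    ((e.prod (.refl 0)).trans ((Path.refl 1).prod e))
    (((Path.refl 0).prod e).trans (e.prod (.refl 1)))
  have H' := H.map f
  rw [Path.map_trans, Path.map_trans] at H'
  have hf (s t : I) : f (s, t) = ⟨(γ s, l t), h _ _⟩ := rfl
  have H'' := H'.pathCast (x₂ := ⟨(a, u), by simpa using h 0 0⟩)
    (x₃ := ⟨(b, v), by simpa using h 1 1⟩)
    (by simp [hf]) (by simp [hf])
  rw [horiz, horiz, vert, vert, ← Path.Homotopic.Quotient.mk_trans,
    ← Path.Homotopic.Quotient.mk_trans, Path.Homotopic.Quotient.eq]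
  convert H'' using 1 <;> ext t <;> simp only [Path.trans_apply, Path.cast_coe] <;> split_ifs <;>
    simp [pairPath, hf, e]

end

/-! ### Pushing loops into a fixed fibre -/

section

variable {V : Type*} [NormedAddCommGroup V] [NormedSpace ℝ V] {O : Set (V × ℂ)} {S : Set V} {M : ℂ}

theorem segment_mem {E : Type*} [AddCommGroup E] [Module ℝ E] [TopologicalSpace E]
    [ContinuousAdd E] [ContinuousSMul ℝ E] {S : Set E} (hS : Convex ℝ S) {a b : E}
    (ha : a ∈ S) (hb : b ∈ S) (t : I) : Path.segment a b t ∈ S :=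
  hS.lineMap_mem ha hb t.2

/-- Supplies the local condition in the connectedness arguments below: a property that holds near T
holds on the whole interval between T and a nearby t. -/
theorem eventually_forall_uIcc {P : I → Prop} {T : I} (h : ∀ᶠ t in 𝓝 T, P t) :
    ∀ᶠ t in 𝓝 T, ∀ s ∈ Set.uIcc T t, P s := by
  obtain ⟨b, c, hT, hbc, hP⟩ := exists_Icc_mem_subset_of_mem_nhds h
  filter_upwards [hbc] with t ht s hs
  exact hP (Set.ordConnected_Icc.uIcc_subset hT ht hs)

/-- The loop `l` in the fibre of `O` over `a` at height `M` can be moved to the fibre over `b`,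
along paths in `S` at height `M`. -/
def AbsorbsLoop (hSO : ∀ a ∈ S, (a, M) ∈ O) (a b : V) (l : Path M M) (hl : ∀ t, (a, l t) ∈ O) :
    Prop :=
  ∃ (l' : Path M M) (hl' : ∀ t, (b, l' t) ∈ O), ∀ (γ : Path b a) (hγ : ∀ t, γ t ∈ S),
    (horiz γ M fun t => hSO _ (hγ t)).trans (vert a l hl) =
      (vert b l' hl').trans (horiz γ M fun t => hSO _ (hγ t))

/-- All loops in the fibre of `O` over `a` at height `M` can be moved to the fibre over `b`. -/
def Absorbs (hSO : ∀ a ∈ S, (a, M) ∈ O) (a b : V) : Prop :=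
  ∀ (l : Path M M) (hl : ∀ t, (a, l t) ∈ O), AbsorbsLoop hSO a b l hl

/-- By convexity of `S` all horizontal paths from c to a are homotopic, so the path may be taken
through b and the loop moved in two stages. -/
theorem AbsorbsLoop.trans (hS : Convex ℝ S) {hSO : ∀ a ∈ S, (a, M) ∈ O} {a b c : V} (ha : a ∈ S)
    (hb : b ∈ S) (hc : c ∈ S) {l : Path M M} {hl : ∀ t, (a, l t) ∈ O}
    (hab : AbsorbsLoop hSO a b l hl) (hbc : Absorbs hSO b c) : AbsorbsLoop hSO a c l hl := by
  obtain ⟨l₁, hl₁, h₁⟩ := hab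
  obtain ⟨l₂, hl₂, h₂⟩ := hbc l₁ hl₁
  refine ⟨l₂, hl₂, fun γ hγ => ?_⟩
  have e := horiz_eq_of_convex hS hSO γ ((Path.segment c b).trans (Path.segment b a)) hγ
    (trans_mem (segment_mem hS hc hb) (segment_mem hS hb ha))
  rw [horiz_trans _ (fun t => hSO _ (segment_mem hS hc hb t)) _
    (fun t => hSO _ (segment_mem hS hb ha t))] at e
  rw [e, Quotient.trans_assoc, h₁ _ (segment_mem hS hb ha), ← Quotient.trans_assoc,
    h₂ _ (segment_mem hS hc hb), Quotient.trans_assoc]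

/-- The basic move: after a homotopy inside its own fibre, the loop avoids the punctures of every
fibre along δ, and then δ × l' is a map of a square into `O`. -/
theorem absorbsLoop_of_square {hSO : ∀ a ∈ S, (a, M) ∈ O} (hS : Convex ℝ S) {a b : V}
    (δ : Path b a) (hδ : ∀ t, δ t ∈ S) (l : Path M M) (hl : ∀ t, (a, l t) ∈ O) (l' : Path M M)
    (hl' : ∀ s t, (δ s, l' t) ∈ O) (e : vert a l hl = vert a l' (by simpa using hl' 1)) :
    AbsorbsLoop hSO a b l hl := by
  refine ⟨l', by simpa using hl' 0, fun γ hγ => ?_⟩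
  rw [horiz_eq_of_convex hS hSO γ δ hγ hδ, e]
  exact horiz_trans_vert _ _ hl' _ _ _ _

/-! ### Normal form of path classes -/

variable {a₀ : V} {u₀ : ℂ}

/-- Classes of paths that run in the fibre over `a₀`, then at height `M`, then in the fibre over
the end point. -/
def IsNormal (hSO : ∀ a ∈ S, (a, M) ∈ O) (h₀ : (a₀, u₀) ∈ O) (y : O)
    (p : Quotient (⟨(a₀, u₀), h₀⟩ : O) y) : Prop :=
  ∃ (l : Path u₀ M) (hl : ∀ t, (a₀, l t) ∈ O) (γ : Path a₀ y.1.1) (hγ : ∀ t, γ t ∈ S)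
    (l' : Path M y.1.2) (hl' : ∀ t, (y.1.1, l' t) ∈ O),
    p = (vert a₀ l hl).trans ((horiz γ M fun t => hSO _ (hγ t)).trans (vert y.1.1 l' hl'))

/-- The vertical end of the normal path and the vertical start of the new piece join to a loop at
height M over a. Absorption moves it across γ to the fibre over a₀, and the two horizontal parts
become adjacent. -/
theorem IsNormal.trans_vert_horiz_vert {hSO : ∀ a ∈ S, (a, M) ∈ O} {h₀ : (a₀, u₀) ∈ O} {a b : V}
    {w w' : ℂ} {hx : (a, w) ∈ O} {hy : (b, w') ∈ O}
    {p : Quotient (⟨(a₀, u₀), h₀⟩ : O) ⟨(a, w), hx⟩}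
    (hp : IsNormal hSO h₀ _ p) (habs : Absorbs hSO a a₀)
    (l₁ : Path w M) (hl₁ : ∀ t, (a, l₁ t) ∈ O) (δ : Path a b) (hδ : ∀ t, δ t ∈ S)
    (l₂ : Path M w') (hl₂ : ∀ t, (b, l₂ t) ∈ O) :
    IsNormal hSO h₀ ⟨(b, w'), hy⟩ (p.trans
      ((vert a l₁ hl₁).trans ((horiz δ M fun t => hSO _ (hδ t)).trans (vert b l₂ hl₂)))) := by
  obtain ⟨l, hl, γ, hγ, l', hl', rfl⟩ := hp
  dsimp only at γ l' hl'
  obtain ⟨l₃, hl₃, e⟩ := habs (l'.trans l₁) (vert_trans_mem hl' hl₁)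
  refine ⟨l.trans l₃, vert_trans_mem hl hl₃, γ.trans δ, trans_mem hγ hδ, l₂, hl₂, ?_⟩
  have e' := e γ hγ
  rw [vert_trans _ hl' _ hl₁] at e'
  rw [vert_trans _ hl _ hl₃, horiz_trans _ (fun t => hSO _ (hγ t)) _ (fun t => hSO _ (hδ t))]
  have e₂ := congrArg (fun z => (vert a₀ l hl).trans (z.trans
    ((horiz δ M fun t => hSO _ (hδ t)).trans (vert b l₂ hl₂)))) e'
  simpa only [Quotient.trans_assoc] using e₂

/-- A short path is the product of a path in a fibre, a path at height `M` and a path in another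
fibre. -/
theorem mk_eq_vert_horiz_vert (hS : Convex ℝ S) {hSO : ∀ a ∈ S, (a, M) ∈ O} {A : Set V}
    (hA : Convex ℝ A) {D : Set ℂ} (hD : Convex ℝ D) (hAD : ∀ a ∈ A, ∀ w ∈ D, (a, w) ∈ O) {w₀ : ℂ}
    (hw₀ : w₀ ∈ D) (l : Path w₀ M) (hl : ∀ a ∈ A, ∀ t, (a, l t) ∈ O) {a b : V} {u v : ℂ}
    {hx : (a, u) ∈ O} {hy : (b, v) ∈ O} (q : Path (⟨(a, u), hx⟩ : O) ⟨(b, v), hy⟩)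
    (hqA : ∀ t, (q t).1.1 ∈ A) (hqS : ∀ t, (q t).1.1 ∈ S) (hqD : ∀ t, (q t).1.2 ∈ D) :
    ∃ (l₁ : Path u M) (hl₁ : ∀ t, (a, l₁ t) ∈ O) (δ : Path a b) (hδ : ∀ t, δ t ∈ S)
      (l₂ : Path M v) (hl₂ : ∀ t, (b, l₂ t) ∈ O), Path.Homotopic.Quotient.mk q =
        (vert a l₁ hl₁).trans ((horiz δ M fun t => hSO _ (hδ t)).trans (vert b l₂ hl₂)) := by
  have haA : a ∈ A := by simpa using hqA 0
  have hbA : b ∈ A := by simpa using hqA 1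
  have haS : a ∈ S := by simpa using hqS 0
  have hbS : b ∈ S := by simpa using hqS 1
  have huD : u ∈ D := by simpa using hqD 0
  have hvD : v ∈ D := by simpa using hqD 1
  have h₁ (t) : (a, Path.segment u w₀ t) ∈ O := hAD _ haA _ (segment_mem hD huD hw₀ t)
  have h₂ (t) : (b, Path.segment w₀ v t) ∈ O := hAD _ hbA _ (segment_mem hD hw₀ hvD t)
  have h₃ (t) : (Path.segment a b t, w₀) ∈ O := hAD _ (segment_mem hA haA hbA t) _ hw₀
  -- The detour goes to w₀ inside the convex box, up to M along l, across, and back down. Pulling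
  -- the horizontal part down along l through a square cancels l against its reverse and leaves a
  -- path inside A × D.
  refine ⟨(Path.segment u w₀).trans l, vert_trans_mem h₁ (hl a haA), Path.segment a b,
    segment_mem hS haS hbS, l.symm.trans (Path.segment w₀ v),
    vert_trans_mem (vert_symm_mem (hl b hbA)) h₂, ?_⟩
  have e₁ := horiz_trans_vert (O := O) (Path.segment a b) l.symm
    (fun s t => hl _ (segment_mem hA haA hbA s) _)
    (fun t => hSO _ (segment_mem hS haS hbS t)) (vert_symm_mem (hl b hbA))
    (vert_symm_mem (hl a haA)) h₃
  have e₂ : Path.Homotopic.Quotient.mk q =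
      (vert a _ h₁).trans ((horiz _ w₀ h₃).trans (vert b _ h₂)) := by
    refine Path.Homotopic.Quotient.eq.2 (homotopic_of_convex (hA.prod hD)
      (fun x hx => hAD _ hx.1 _ hx.2) _ _
      (fun t => ⟨hqA t, hqD t⟩) ?_)
    refine trans_mem (s := Subtype.val ⁻¹' (A ×ˢ D)) (fun t => ⟨haA, ?_⟩)
      (trans_mem (s := Subtype.val ⁻¹' (A ×ˢ D)) (fun t => ⟨?_, hw₀⟩) fun t => ⟨hbA, ?_⟩)
    · exact segment_mem hD huD hw₀ t
    · exact segment_mem hA haA hbA t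
    · exact segment_mem hD hw₀ hvD t
  rw [e₂, vert_trans _ h₁ _ (hl a haA), vert_trans _ (vert_symm_mem (hl b hbA)) _ h₂]
  rw [Quotient.trans_assoc, ← Quotient.trans_assoc (horiz _ M _), e₁, Quotient.trans_assoc,
    ← Quotient.trans_assoc (vert a l _), vert_trans_symm, Quotient.refl_trans]

/-- Preservation of normality under appending the subpath from t₁ to t₂ is transitive in these
parameters, so by connectedness of the unit interval only short subpaths matter. -/
theorem isNormal_subpath (hO : IsOpen O) (hS : Convex ℝ S) {hSO : ∀ a ∈ S, (a, M) ∈ O} {S₀ : Set V}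
    (hS₀ : S₀ ⊆ S)
    (hconn : ∀ a w w', (a, w) ∈ O → (a, w') ∈ O → ∃ l : Path w w', ∀ t, (a, l t) ∈ O)
    {h₀ : (a₀, u₀) ∈ O} (habs : ∀ a ∈ S₀, Absorbs hSO a a₀) {x y : O} (q : Path x y)
    (hq : ∀ t, (q t).1.1 ∈ S₀) (t₁ t₂ : I) (p : Quotient (⟨(a₀, u₀), h₀⟩ : O) (q t₁))
    (hp : IsNormal hSO h₀ _ p) : IsNormal hSO h₀ _ (p.trans (.mk (q.subpath t₁ t₂))) := by
  refine isPreconnected_univ.induction₂' (fun t₁ t₂ : I => ∀ p, IsNormal hSO h₀ (q t₁) p →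
    IsNormal hSO h₀ _ (p.trans (.mk (q.subpath t₁ t₂)))) ?_ ?_ (Set.mem_univ t₁) (Set.mem_univ t₂)
    p hp
  · intro T _
    obtain ⟨l, hl⟩ := hconn (q T).1.1 (q T).1.2 M (q T).2 (hSO _ (hS₀ (hq T)))
    have h1 : ∀ᶠ z in 𝓝 (q T).1, z ∈ O := hO.mem_nhds (q T).2
    -- Tube lemma: the compact path l from q(T) up to height M stays in the open set `O` when its
    -- base point a is perturbed.
    have h2 : ∀ᶠ a in 𝓝 (q T).1.1, ∀ t, (a, l t) ∈ O := by
      have := isCompact_univ.eventually_forall_of_forall_eventually (Y := I) (x₀ := (q T).1.1)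
        (P := fun a t => (a, l t) ∈ O) fun t _ => by
          have hc : Continuous fun z : V × I => (z.1, l z.2) := by fun_prop
          exact hc.continuousAt.eventually (hO.mem_nhds (hl t))
      filter_upwards [this] with a ha t using ha t trivial
    rw [nhds_prod_eq] at h1
    obtain ⟨pa, hpa, pb, hpb, hab⟩ := Filter.eventually_prod_iff.1 h1
    obtain ⟨ε, hε, hA⟩ := Metric.eventually_nhds_iff_ball.1 (hpa.and h2)
    obtain ⟨ε', hε', hD⟩ := Metric.eventually_nhds_iff_ball.1 hpb
    have hc1 : Continuous fun t => (q t).1 := by fun_prop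
    have hev : ∀ᶠ t in 𝓝 T, (q t).1 ∈ Metric.ball (q T).1.1 ε ×ˢ Metric.ball (q T).1.2 ε' :=
      hc1.continuousAt.eventually ((Metric.isOpen_ball.prod Metric.isOpen_ball).mem_nhds
        ⟨Metric.mem_ball_self hε, Metric.mem_ball_self hε'⟩)
    have key (s₁ s₂ : I) (hs : ∀ s ∈ Set.uIcc s₁ s₂, (q s).1 ∈ Metric.ball (q T).1.1 ε ×ˢ
        Metric.ball (q T).1.2 ε') (p) (hp : IsNormal hSO h₀ (q s₁) p) :
        IsNormal hSO h₀ _ (p.trans (.mk (q.subpath s₁ s₂))) := by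
      have hr (t) : ∃ s ∈ Set.uIcc s₁ s₂, q s = q.subpath s₁ s₂ t := by
        have : q.subpath s₁ s₂ t ∈ Set.range (q.subpath s₁ s₂) := ⟨t, rfl⟩
        rwa [Path.range_subpath] at this
      obtain ⟨l₁, hl₁, δ, hδ, l₂, hl₂, e⟩ := mk_eq_vert_horiz_vert (hSO := hSO) hS
        (convex_ball (q T).1.1 ε) (convex_ball (q T).1.2 ε')
        (fun a ha w hw => hab (hA a ha).1 (hD w hw)) (Metric.mem_ball_self hε') l
        (fun a ha => (hA a ha).2) (q.subpath s₁ s₂)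
        (fun t => by obtain ⟨s, hs', e⟩ := hr t; rw [← e]; exact (hs s hs').1)
        (fun t => by obtain ⟨s, hs', e⟩ := hr t; rw [← e]; exact hS₀ (hq s))
        (fun t => by obtain ⟨s, hs', e⟩ := hr t; rw [← e]; exact (hs s hs').2)
      rw [e]
      exact hp.trans_vert_horiz_vert (habs _ (hq s₁)) l₁ hl₁ δ hδ l₂ hl₂
    rw [nhdsWithin_univ]
    filter_upwards [eventually_forall_uIcc hev] with t ht
    exact ⟨key _ _ ht, key _ _ fun s hs => ht s (Set.uIcc_comm t T ▸ hs)⟩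
  · intro r s t _ _ _ hrs hst p hp
    have := hst _ (hrs p hp)
    rwa [Quotient.trans_assoc, ← Path.Homotopic.Quotient.mk_trans,
      Path.Homotopic.Quotient.eq.2 ⟨Path.Homotopy.subpathTransSubpath q r s t⟩] at this

/-- If all loops in fibres can be moved to the fibre over `a₀`, then this fibre carries the
fundamental group. -/
theorem exists_vert_eq (hO : IsOpen O) (hS : Convex ℝ S) {hSO : ∀ a ∈ S, (a, M) ∈ O} {S₀ : Set V}
    (hS₀ : S₀ ⊆ S)
    (hconn : ∀ a w w', (a, w) ∈ O → (a, w') ∈ O → ∃ l : Path w w', ∀ t, (a, l t) ∈ O)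
    {h₀ : (a₀, u₀) ∈ O} (habs : ∀ a ∈ S₀, Absorbs hSO a a₀)
    (q : Path (⟨(a₀, u₀), h₀⟩ : O) ⟨(a₀, u₀), h₀⟩) (hq : ∀ t, (q t).1.1 ∈ S₀) :
    ∃ (l : Path u₀ u₀) (hl : ∀ t, (a₀, l t) ∈ O), Path.Homotopic.Quotient.mk q = vert a₀ l hl := by
  have ha₀ : a₀ ∈ S := hS₀ (by simpa using hq 0)
  obtain ⟨l, hl⟩ := hconn a₀ u₀ M h₀ (hSO _ ha₀)
  have hrefl : IsNormal hSO h₀ ⟨(a₀, u₀), h₀⟩ (.refl _) := by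
    refine ⟨l, hl, .refl _, fun _ => ha₀, l.symm, vert_symm_mem hl, ?_⟩
    have : horiz (.refl a₀) M (fun t => hSO _ ha₀) = .refl (⟨(a₀, M), hSO _ ha₀⟩ : O) := rfl
    rw [this, Quotient.refl_trans, vert_trans_symm]
  have key : IsNormal hSO h₀ ⟨(a₀, u₀), h₀⟩ (Path.Homotopic.Quotient.mk q) := by
    -- The end points of `q.subpath 0 1` equal the base point only propositionally, hence the detour
    -- through general end points and a cast.
    have h (z z' : O) (hz : ⟨(a₀, u₀), h₀⟩ = z) (hz' : ⟨(a₀, u₀), h₀⟩ = z') (q' : Path z z')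
        (H : ∀ p, IsNormal hSO h₀ z p → IsNormal hSO h₀ z' (p.trans (.mk q'))) :
        IsNormal hSO h₀ ⟨(a₀, u₀), h₀⟩ (Path.Homotopic.Quotient.mk (q'.cast hz hz')) := by
      subst hz hz'
      simpa using H _ hrefl
    have := h _ _ q.source.symm q.target.symm (q.subpath 0 1)
      (isNormal_subpath hO hS hS₀ hconn habs q hq 0 1)
    simpa [Path.subpath_zero_one] using this
  obtain ⟨l₁, hl₁, γ, hγ, l₂, hl₂, e⟩ := key
  dsimp only at γ l₂ hl₂ e
  rw [horiz_eq_of_convex hS hSO γ (.refl _) hγ (fun _ => ha₀)] at e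
  have e' : horiz (.refl a₀) M (fun t => hSO _ ha₀) = .refl (⟨(a₀, M), hSO _ ha₀⟩ : O) := rfl
  refine ⟨l₁.trans l₂, vert_trans_mem hl₁ hl₂, ?_⟩
  rw [e, vert_trans _ hl₁ _ hl₂]
  congr 1
  exact Quotient.refl_trans _

end

/-! ### Fibres that are complements of moving points -/

section

variable {ι : Type*} [Finite ι]

/-- A path in the complement of finitely many points can be pushed away from these points. -/
theorem exists_homotopy_away (b : ι → ℂ) {ρ : ℝ} (hρ : 0 < ρ)
    (hb : ∀ i j, i ≠ j → 2 * ρ ≤ ‖b i - b j‖) {u v : ℂ} (l : Path u v) (hl : ∀ t i, l t ≠ b i)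
    (hu : ∀ i, ρ ≤ ‖u - b i‖) (hv : ∀ i, ρ ≤ ‖v - b i‖) :
    ∃ (l' : Path u v) (F : l.Homotopy l'), (∀ t i, ρ ≤ ‖l' t - b i‖) ∧ ∀ x i, F x ≠ b i := by
  classical
  cases nonempty_fintype ι
  -- Radial push out of the discs of radius ρ around the b i. A summand vanishes outside its disc,
  -- and the open discs are disjoint, so at most one acts at z; it changes the distance r to b i
  -- into r + s (ρ - r), which is ρ at s = 1.
  let φ (s : ℝ) (z : ℂ) : ℂ := z + (s : ℂ) * ∑ i, ((max 0 (ρ / ‖z - b i‖ - 1) : ℝ) : ℂ) * (z - b i)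
  have hfar (z : ℂ) (hz : ∀ i, ρ ≤ ‖z - b i‖) (s : ℝ) : φ s z = z := by
    have : ∑ i, ((max 0 (ρ / ‖z - b i‖ - 1) : ℝ) : ℂ) * (z - b i) = 0 := by
      refine Finset.sum_eq_zero fun i _ => ?_
      rw [max_eq_left, Complex.ofReal_zero, zero_mul]
      rw [sub_nonpos]
      exact div_le_one_of_le₀ (hz i) (norm_nonneg _)
    simp [φ, this]
  have hnear (z : ℂ) (i : ι) (h0 : z ≠ b i) (hz : ‖z - b i‖ < ρ) (s : ℝ)
      (hs : 0 ≤ s) (hs' : s ≤ 1) :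
      ‖φ s z - b i‖ = ‖z - b i‖ + s * (ρ - ‖z - b i‖) := by
    have hpos : 0 < ‖z - b i‖ := norm_pos_iff.2 (sub_ne_zero.2 h0)
    have hsum : ∑ j, ((max 0 (ρ / ‖z - b j‖ - 1) : ℝ) : ℂ) * (z - b j) =
        ((ρ / ‖z - b i‖ - 1 : ℝ) : ℂ) * (z - b i) := by
      rw [Finset.sum_eq_single i]
      · rw [max_eq_right]
        rw [sub_nonneg]
        exact (one_le_div hpos).2 hz.le
      · intro j _ hj
        have h1 : 2 * ρ ≤ ‖z - b j‖ + ‖z - b i‖ := by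
          refine (hb j i hj).trans ?_
          rw [norm_sub_rev z (b j)]
          simpa using norm_add_le (b j - z) (z - b i)
        rw [max_eq_left, Complex.ofReal_zero, zero_mul]
        rw [sub_nonpos]
        exact div_le_one_of_le₀ (by linarith) (norm_nonneg _)
      · simp
    have : φ s z - b i = ((1 + s * (ρ / ‖z - b i‖ - 1) : ℝ) : ℂ) * (z - b i) := by
      simp only [φ, hsum]
      push_cast
      ring
    rw [this, norm_mul, Complex.norm_real, Real.norm_of_nonneg]
    · field_simp
    · have := (one_le_div hpos).2 hz.le
      nlinarith
  have hdist (z : ℂ) (i j : ι) (hz : ‖z - b i‖ ≤ ρ) (hij : i ≠ j) : ρ ≤ ‖z - b j‖ := by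
    have h1 : ‖b i - b j‖ ≤ ‖z - b i‖ + ‖z - b j‖ := by
      rw [norm_sub_rev z (b i)]
      simpa using norm_add_le (b i - z) (z - b j)
    linarith [hb i j hij]
  have hle (z : ℂ) (hz : ∀ i, z ≠ b i) (s : ℝ) (hs : 0 ≤ s) (hs' : s ≤ 1) (j : ι) :
      min ρ (‖z - b j‖ + s * (ρ - ‖z - b j‖)) ≤ ‖φ s z - b j‖ := by
    by_cases h : ∃ i, ‖z - b i‖ < ρ
    · obtain ⟨i, hi⟩ := h
      have e := hnear z i (hz i) hi s hs hs'
      obtain rfl | hij := eq_or_ne i j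
      · rw [e]
        exact min_le_right _ _
      · exact (min_le_left _ _).trans (hdist _ i j (by rw [e]; nlinarith) hij)
    · push Not at h
      rw [hfar z h]
      exact (min_le_left _ _).trans (h j)
  have hcont : Continuous fun x : I × I => φ x.1 (l x.2) := by
    refine Continuous.add (by fun_prop) (Continuous.mul (by fun_prop) ?_)
    refine continuous_finsetSum _ fun i _ => Continuous.mul ?_ (by fun_prop)
    refine Complex.continuous_ofReal.comp (continuous_const.max (Continuous.sub ?_ continuous_const))
    exact continuous_const.div (by fun_prop) fun x => (norm_pos_iff.2 (sub_ne_zero.2 (hl _ _))).ne'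
  have hc1 : Continuous fun t : I => φ (1 : I) (l t) :=
    hcont.comp (by fun_prop : Continuous fun t : I => ((1 : I), t))
  refine ⟨⟨⟨fun t => φ (1 : I) (l t), hc1⟩, ?_, ?_⟩,
    { toFun := fun x => φ x.1 (l x.2)
      continuous_toFun := hcont
      map_zero_left := fun t => by simp [φ]
      map_one_left := fun t => rfl
      prop' := ?_ }, fun t i => ?_, fun x i => ?_⟩
  · simp [hfar u hu]
  · simp [hfar v hv]
  · rintro s t (rfl | rfl) <;> simp [hfar u hu, hfar v hv]
  · have := hle (l t) (hl t) 1 zero_le_one le_rfl i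
    simpa using this
  · have h1 := hle (l x.2) (hl x.2) x.1 x.1.2.1 x.1.2.2 i
    have h2 : 0 < ‖l x.2 - b i‖ := norm_pos_iff.2 (sub_ne_zero.2 (hl _ _))
    have h3 : 0 < ‖l x.2 - b i‖ + x.1 * (ρ - ‖l x.2 - b i‖) := by
      rcases x.1.2.1.eq_or_lt with h | h
      · simpa [← h] using h2
      · nlinarith [x.1.2.2]
    exact sub_ne_zero.1 (norm_pos_iff.1 ((lt_min hρ h3).trans_le h1))

variable {V : Type*} [NormedAddCommGroup V] [NormedSpace ℝ V] {O : Set (V × ℂ)} {S : Set V} {M : ℂ}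

/-- If over the path `c` the fibres of `O` are the complements of moving points, and these are
distinct except at the start, then the loops over the start can be moved to the end. -/
theorem absorbs_of_injective (hO : IsOpen O) (hS : Convex ℝ S) (hSO : ∀ a ∈ S, (a, M) ∈ O) {a b : V}
    (c : Path a b) (hc : ∀ t, c t ∈ S) (v : ι → C(I, ℂ))
    (hv : ∀ t w, (c t, w) ∈ O ↔ ∀ i, w ≠ v i t)
    (hinj : ∀ t, t ≠ 0 → Function.Injective fun i => v i t) : Absorbs hSO a b := by
  -- Away from the start the punctures are distinct, and the fibres are locally trivial along c in
  -- both directions.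
  have hloc (T : I) (hT : T ≠ 0) :
      ∀ᶠ t in 𝓝 T, Absorbs hSO (c T) (c t) ∧ Absorbs hSO (c t) (c T) := by
    obtain ⟨d, hd, hd1, hd2⟩ : ∃ d > 0, (∀ i j, i ≠ j → d ≤ ‖v i T - v j T‖) ∧
        ∀ i, d ≤ ‖M - v i T‖ := by
      have h1 : ∀ᶠ d in 𝓝[>] (0 : ℝ), ∀ i j, i ≠ j → d ≤ ‖v i T - v j T‖ := by
        refine Filter.eventually_all.2 fun i => Filter.eventually_all.2 fun j => ?_
        by_cases hij : i = j
        · simp [hij]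
        · have : 0 < ‖v i T - v j T‖ := norm_pos_iff.2 (sub_ne_zero.2 ((hinj T hT).ne hij))
          filter_upwards [nhdsWithin_le_nhds (Iic_mem_nhds this)] with d hd _ using hd
      have h2 : ∀ᶠ d in 𝓝[>] (0 : ℝ), ∀ i, d ≤ ‖M - v i T‖ := by
        refine Filter.eventually_all.2 fun i => ?_
        have : 0 < ‖M - v i T‖ := norm_pos_iff.2 (sub_ne_zero.2 ((hv T M).1 (hSO _ (hc T)) i))
        exact nhdsWithin_le_nhds (Iic_mem_nhds this)
      obtain ⟨d, ⟨h1, h2⟩, h3⟩ := ((h1.and h2).and self_mem_nhdsWithin).exists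
      exact ⟨d, h3, h1, h2⟩
    have hev : ∀ᶠ t in 𝓝 T, ∀ i, ‖v i t - v i T‖ < d / 8 := by
      refine Filter.eventually_all.2 fun i => ?_
      have := (v i).continuous.continuousAt.eventually
        (Metric.ball_mem_nhds (v i T) (by positivity : 0 < d / 8))
      simpa [dist_eq_norm] using this
    have key (t₁ t₂ : I) (h : ∀ s ∈ Set.uIcc t₁ t₂, ∀ i, ‖v i s - v i T‖ < d / 8) :
        Absorbs hSO (c t₁) (c t₂) := by
      intro l hl
      have ht (i) := h t₁ Set.left_mem_uIcc i
      -- At t₁ the punctures are more than 3d/4 ≥ 2ρ apart, where ρ = d/4. Between t₁ and t₂ each of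
      -- them stays within 2 · d/8 = ρ of its position at t₁, so it never meets l'.
      obtain ⟨l', F, hl', hF⟩ := exists_homotopy_away (fun i => v i t₁) (ρ := d / 4) (by positivity)
        (fun i j hij => by
          have e : v i T - v j T = (v i t₁ - v j t₁) - (v i t₁ - v i T) + (v j t₁ - v j T) := by ring
          have h3 := hd1 i j hij
          rw [e] at h3
          linarith [norm_add_le ((v i t₁ - v j t₁) - (v i t₁ - v i T)) (v j t₁ - v j T),
            norm_sub_le (v i t₁ - v j t₁) (v i t₁ - v i T), ht i, ht j]) l
        (fun t i => (hv _ _).1 (hl t) i)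
        (fun i => by linarith [hd2 i, ht i, norm_sub_le_norm_sub_add_norm_sub M (v i t₁) (v i T)])
        (fun i => by linarith [hd2 i, ht i, norm_sub_le_norm_sub_add_norm_sub M (v i t₁) (v i T)])
      refine absorbsLoop_of_square hS (c.subpath t₂ t₁) (fun t => hc _) l hl l' (fun s t => ?_)
        (vert_eq_of_homotopy hl _ F fun x => (hv _ _).2 fun i => hF x i)
      obtain ⟨r, hr, e⟩ : c.subpath t₂ t₁ s ∈ c '' Set.uIcc t₂ t₁ := by
        rw [← Path.range_subpath]
        exact ⟨s, rfl⟩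
      rw [← e, hv]
      intro i hi
      have h4 := hl' t i
      have h5 := h r (Set.uIcc_comm t₁ t₂ ▸ hr) i
      have e : l' t - v i t₁ = (v i r - v i T) - (v i t₁ - v i T) := by rw [hi]; ring
      rw [e] at h4
      linarith [norm_sub_le (v i r - v i T) (v i t₁ - v i T), ht i]
    filter_upwards [eventually_forall_uIcc hev] with t ht
    exact ⟨key _ _ ht, key _ _ fun s hs => ht s (Set.uIcc_comm t T ▸ hs)⟩
  have hpos (t : I) (ht : t ≠ 0) : Absorbs hSO (c t) (c 1) := by
    have hpre : IsPreconnected (Set.Ioi (0 : I)) := Set.ordConnected_Ioi.isPreconnected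
    refine hpre.induction₂' (fun s t => Absorbs hSO (c s) (c t))
      (fun x hx => nhdsWithin_le_nhds (hloc x hx.ne')) ?_ (unitInterval.pos_iff_ne_zero.2 ht)
      (by simp : (1 : I) ∈ Set.Ioi 0)
    exact fun x y z _ _ _ h h' l hl => (h l hl).trans hS (hc _) (hc _) (hc _) h'
  suffices H : Absorbs hSO (c 0) (c 1) by simpa using H
  intro l hl
  -- At the start the punctures may coincide and there is no local triviality; openness of `O` alone
  -- keeps the given loop l admissible for a short time.
  have h0 : ∀ᶠ t in 𝓝 (0 : I), ∀ s, (c t, l s) ∈ O := by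
    have := isCompact_univ.eventually_forall_of_forall_eventually (Y := I) (x₀ := (0 : I))
      (P := fun t s => (c t, l s) ∈ O) fun t _ => by
        have hc : Continuous fun z : I × I => (c z.1, l z.2) := by fun_prop
        exact hc.continuousAt.eventually (hO.mem_nhds (hl t))
    filter_upwards [this] with a ha t using ha t trivial
  obtain ⟨t, ht, ht0⟩ : ∃ t : I, (∀ r ∈ Set.uIcc 0 t, ∀ s, (c r, l s) ∈ O) ∧ t ≠ 0 := by
    have h1 : ∀ᶠ t in 𝓝[≠] (0 : I), ∀ r ∈ Set.uIcc 0 t, ∀ s, (c r, l s) ∈ O :=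
      nhdsWithin_le_nhds (eventually_forall_uIcc h0)
    obtain ⟨t, h1, h2⟩ := (h1.and self_mem_nhdsWithin).exists
    exact ⟨t, h1, h2⟩
  refine AbsorbsLoop.trans hS (hc _) (hc t) (hc _) ?_ (hpos t ht0)
  refine absorbsLoop_of_square hS (c.subpath t 0) (fun _ => hc _) l hl l (fun s r => ?_) rfl
  obtain ⟨r', hr, e⟩ : c.subpath t 0 s ∈ c '' Set.uIcc t 0 := by
    rw [← Path.range_subpath]
    exact ⟨s, rfl⟩
  rw [← e]
  exact ht _ (Set.uIcc_comm t 0 ▸ hr) _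

end

/-! ### Monic polynomials with varying coefficients -/

section

variable {m : ℕ}

/-- The monic polynomial of degree `m + 1` with the given lower coefficients. -/
def monicPoly (a : Fin (m + 1) → ℂ) : ℂ[X] := X ^ (m + 1) + ∑ i : Fin (m + 1), C (a i) * X ^ (i : ℕ)

theorem coeff_monicPoly_of_lt (a : Fin (m + 1) → ℂ) (i : Fin (m + 1)) :
    (monicPoly a).coeff i = a i := by
  simp only [monicPoly, coeff_add, coeff_X_pow, finsetSum_coeff, coeff_C_mul]
  rw [if_neg i.2.ne, zero_add, Finset.sum_eq_single i]
  · simp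
  · intro j _ hj
    rw [if_neg fun h => hj (Fin.ext h.symm), mul_zero]
  · simp

theorem degree_lower_lt (a : Fin (m + 1) → ℂ) :
    (∑ i : Fin (m + 1), C (a i) * X ^ (i : ℕ)).degree < ((m + 1 : ℕ) : WithBot ℕ) := by
  refine (degree_sum_le _ _).trans_lt ((Finset.sup_lt_iff (WithBot.bot_lt_coe _)).2 fun i _ => ?_)
  exact (degree_C_mul_X_pow_le _ _).trans_lt (by exact_mod_cast i.2)

theorem monic_monicPoly (a : Fin (m + 1) → ℂ) : (monicPoly a).Monic :=
  monic_X_pow_add (degree_lower_lt a)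

theorem natDegree_monicPoly (a : Fin (m + 1) → ℂ) : (monicPoly a).natDegree = m + 1 := by
  refine natDegree_eq_of_degree_eq_some ?_
  rw [monicPoly, degree_add_eq_left_of_degree_lt, degree_X_pow]
  rw [degree_X_pow]
  exact degree_lower_lt a

theorem monicPoly_coeff {p : ℂ[X]} (hp : p.Monic) (hd : p.natDegree = m + 1) :
    monicPoly (fun i : Fin (m + 1) => p.coeff i) = p := by
  conv_rhs => rw [hp.as_sum, hd]
  rw [monicPoly, Finset.sum_range]

theorem eval_monicPoly (a : Fin (m + 1) → ℂ) (z : ℂ) :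
    (monicPoly a).eval z = z ^ (m + 1) + ∑ i : Fin (m + 1), a i * z ^ (i : ℕ) := by
  simp [monicPoly, eval_finsetSum]

theorem eval_derivative_monicPoly (a : Fin (m + 1) → ℂ) (z : ℂ) :
    (derivative (monicPoly a)).eval z =
      (m + 1) * z ^ m + ∑ i : Fin (m + 1), a i * (i * z ^ ((i : ℕ) - 1)) := by
  simp [monicPoly, eval_finsetSum, derivative_X_pow]

theorem continuous_eval_monicPoly :
    Continuous fun x : (Fin (m + 1) → ℂ) × ℂ => (monicPoly x.1).eval x.2 := by
  simp only [eval_monicPoly]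
  fun_prop

theorem continuous_eval_derivative_monicPoly :
    Continuous fun x : (Fin (m + 1) → ℂ) × ℂ => (derivative (monicPoly x.1)).eval x.2 := by
  simp only [eval_derivative_monicPoly]
  fun_prop

/-! ### Bounds for critical points and preimages -/

theorem norm_le_of_isRoot {p : ℂ[X]} (hp : p ≠ 0) {r : ℝ} (hr : 0 ≤ r)
    (h : ∀ i < p.natDegree, ‖p.coeff i‖ ≤ r * ‖p.leadingCoeff‖) {z : ℂ} (hz : p.eval z = 0) :
    ‖z‖ ≤ r + 1 := by
  have h1 := IsRoot.norm_lt_cauchyBound hp hz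
  lift r to NNReal using hr
  refine (NNReal.coe_le_coe.2 (h1.le.trans (?_ : _ ≤ r + 1))).trans_eq (by simp)
  rw [cauchyBound]
  gcongr
  rw [div_le_iff₀ (nnnorm_pos.2 (leadingCoeff_ne_zero.2 hp))]
  refine Finset.sup_le fun i hi => ?_
  exact_mod_cast h i (Finset.mem_range.1 hi)

theorem coeff_derivative_monicPoly_top (a : Fin (m + 1) → ℂ) :
    (derivative (monicPoly a)).coeff m = m + 1 := by
  have h := (monic_monicPoly a).coeff_natDegree
  rw [natDegree_monicPoly] at h
  rw [coeff_derivative, h, one_mul]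

theorem derivative_monicPoly_ne_zero (a : Fin (m + 1) → ℂ) : derivative (monicPoly a) ≠ 0 := by
  intro h
  have := coeff_derivative_monicPoly_top a
  rw [h, coeff_zero] at this
  exact Nat.cast_add_one_ne_zero m this.symm

theorem natDegree_derivative_monicPoly (a : Fin (m + 1) → ℂ) :
    (derivative (monicPoly a)).natDegree = m := by
  refine le_antisymm ?_ ?_
  · have := natDegree_derivative_le (monicPoly a)
    rwa [natDegree_monicPoly] at this
  · refine le_natDegree_of_ne_zero ?_
    rw [coeff_derivative_monicPoly_top]
    exact Nat.cast_add_one_ne_zero m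

theorem leadingCoeff_derivative_monicPoly (a : Fin (m + 1) → ℂ) :
    (derivative (monicPoly a)).leadingCoeff = m + 1 := by
  rw [leadingCoeff, natDegree_derivative_monicPoly, coeff_derivative_monicPoly_top]

theorem norm_le_of_critical {a : Fin (m + 1) → ℂ} {r : ℝ} (ha : ‖a‖ ≤ r) {z : ℂ}
    (hz : (derivative (monicPoly a)).eval z = 0) : ‖z‖ ≤ r + 1 := by
  have hr : 0 ≤ r := (norm_nonneg _).trans ha
  refine norm_le_of_isRoot (derivative_monicPoly_ne_zero a) hr (fun i hi => ?_) hz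
  rw [natDegree_derivative_monicPoly] at hi
  have e := coeff_monicPoly_of_lt a ⟨i + 1, by omega⟩
  dsimp only at e
  rw [leadingCoeff_derivative_monicPoly, coeff_derivative, e, norm_mul]
  have h1 : ‖(i + 1 : ℂ)‖ ≤ ‖(m + 1 : ℂ)‖ := by
    have h2 : ‖((i + 1 : ℕ) : ℂ)‖ ≤ ‖((m + 1 : ℕ) : ℂ)‖ := by
      rw [Complex.norm_natCast, Complex.norm_natCast]
      exact_mod_cast by omega
    simpa using h2
  gcongr
  exact (norm_le_pi_norm a _).trans ha

theorem norm_le_of_eval_eq {a : Fin (m + 1) → ℂ} {w : ℂ} {r : ℝ} (ha : ‖a‖ ≤ r) (hw : ‖w‖ ≤ r)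
    {z : ℂ} (hz : (monicPoly a).eval z = w) : ‖z‖ ≤ r + r + 1 := by
  have hr : 0 ≤ r := (norm_nonneg _).trans ha
  have hd : (monicPoly a - C w).natDegree = m + 1 := by rw [natDegree_sub_C, natDegree_monicPoly]
  have hm : (monicPoly a - C w).Monic := by
    refine (monic_monicPoly a).sub_of_left (degree_C_le.trans_lt ?_)
    rw [← natDegree_pos_iff_degree_pos, natDegree_monicPoly]
    exact Nat.succ_pos m
  refine norm_le_of_isRoot hm.ne_zero (by positivity) (fun i hi => ?_) (by simp [hz])
  rw [hd] at hi
  rw [hm.leadingCoeff, norm_one, mul_one, coeff_sub]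
  have e := coeff_monicPoly_of_lt a ⟨i, hi⟩
  dsimp only at e
  rw [e, coeff_C]
  refine (norm_sub_le _ _).trans (add_le_add ((norm_le_pi_norm a _).trans ha) ?_)
  split_ifs
  · exact hw
  · simpa using hr

/-- The map `(a, z) ↦ (a, p_a(z))`, where `p_a` is the polynomial with coefficients `a`. -/
def evalMap (x : (Fin (m + 1) → ℂ) × ℂ) : (Fin (m + 1) → ℂ) × ℂ := (x.1, (monicPoly x.1).eval x.2)

/-- Cauchy's root bound controls z by the coefficients and the value, so preimages of bounded sets
are bounded. Properness yields both the openness of `regular m` and the covering property. -/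
theorem isProperMap_evalMap : IsProperMap (evalMap (m := m)) := by
  have hc : Continuous (evalMap (m := m)) := continuous_fst.prodMk continuous_eval_monicPoly
  refine isProperMap_iff_isCompact_preimage.2 ⟨hc, fun K hK => ?_⟩
  obtain ⟨r, hr⟩ := hK.isBounded.exists_norm_le
  refine (isCompact_closedBall (0 : (Fin (m + 1) → ℂ) × ℂ) (r + r + 1)).of_isClosed_subset
    (hK.isClosed.preimage hc) fun x hx => ?_
  have h := hr _ hx
  have h1 : ‖x.1‖ ≤ r := (norm_fst_le (evalMap x)).trans h
  have h2 : ‖(monicPoly x.1).eval x.2‖ ≤ r := (norm_snd_le (evalMap x)).trans h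
  rw [mem_closedBall_zero_iff, Prod.norm_def]
  exact max_le (by linarith [norm_nonneg x.1]) (norm_le_of_eval_eq h1 h2 rfl)

/-- The pairs of a monic polynomial and a point outside its branch locus. -/
def regular (m : ℕ) : Set ((Fin (m + 1) → ℂ) × ℂ) := {x | x.2 ∉ branchLocus (monicPoly x.1)}

theorem compl_regular :
    (regular m)ᶜ = evalMap '' {x | (derivative (monicPoly x.1)).eval x.2 = 0} := by
  ext ⟨a, w⟩
  simp only [regular, branchLocus, Set.mem_compl_iff, Set.mem_ofPred_eq, not_not, Set.mem_image,
    Prod.exists, evalMap, Prod.mk.injEq]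
  constructor
  · rintro ⟨z, hz, rfl⟩
    exact ⟨a, z, hz, rfl, rfl⟩
  · rintro ⟨_, z, hz, rfl, rfl⟩
    exact ⟨z, hz, rfl⟩

theorem isOpen_regular : IsOpen (regular m) := by
  rw [← isClosed_compl_iff, compl_regular]
  exact isProperMap_evalMap.isClosedMap _
    (isClosed_singleton.preimage continuous_eval_derivative_monicPoly)

theorem finite_branchLocus {p : ℂ[X]} (hp : derivative p ≠ 0) : (branchLocus p).Finite := by
  refine Set.Finite.image _ ?_
  have : {z | p.derivative.eval z = 0} = p.derivative.rootSet ℂ := by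
    ext z
    simp [mem_rootSet, hp]
  rw [this]
  exact rootSet_finite _ _

theorem exists_path_regular (a : Fin (m + 1) → ℂ) (w w' : ℂ) (h : (a, w) ∈ regular m)
    (h' : (a, w') ∈ regular m) : ∃ l : Path w w', ∀ t, (a, l t) ∈ regular m := by
  have := (finite_branchLocus (derivative_monicPoly_ne_zero a)).countable
    |>.isPathConnected_compl_of_one_lt_rank (by rw [Complex.rank_real_complex]; norm_num)
  obtain ⟨l, hl⟩ := this.joinedIn w h w' h'
  exact ⟨l, hl⟩

/-- Critical points of polynomials with coefficients in a ball stay in a compact set, so their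
values are bounded, and any M of larger modulus works. -/
theorem exists_mem_regular (r : ℝ) :
    ∃ M : ℂ, ∀ a ∈ Metric.closedBall (0 : Fin (m + 1) → ℂ) r, (a, M) ∈ regular m := by
  have hK : IsCompact (evalMap '' (Metric.closedBall (0 : Fin (m + 1) → ℂ) r ×ˢ
      Metric.closedBall (0 : ℂ) (r + 1))) :=
    ((isCompact_closedBall _ _).prod (isCompact_closedBall _ _)).image
      isProperMap_evalMap.continuous
  obtain ⟨R, hR⟩ := hK.isBounded.exists_norm_le
  refine ⟨(|R| + 1 : ℝ), fun a ha hM => ?_⟩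
  obtain ⟨z, hz, e⟩ := hM
  have h := (norm_snd_le _).trans (hR _ ⟨(a, z), ⟨ha, mem_closedBall_zero_iff.2
    (norm_le_of_critical (mem_closedBall_zero_iff.1 ha) hz)⟩, rfl⟩)
  simp only [evalMap] at h e
  rw [e, Complex.norm_real, Real.norm_of_nonneg (by positivity)] at h
  linarith [le_abs_self R]

end

/-! ### Monic polynomials with given critical points -/

section

variable {m : ℕ}

/-- The lower coefficients of the monic polynomial with critical points `ζ` and constant term
`k`. -/
def critCoeff (ζ : Fin m → ℂ) (k : ℂ) : Fin (m + 1) → ℂ :=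
  Fin.cons k fun j => (m + 1) / (j + 1) * (∏ i, (X - C (ζ i))).coeff j

theorem derivative_critCoeff (ζ : Fin m → ℂ) (k : ℂ) :
    derivative (monicPoly (critCoeff ζ k)) = C ((m : ℂ) + 1) * ∏ i, (X - C (ζ i)) := by
  have hm : (∏ i, (X - C (ζ i))).Monic := monic_prod_of_monic _ _ fun i _ => monic_X_sub_C _
  have hd : (∏ i, (X - C (ζ i))).natDegree = m := by
    rw [natDegree_prod_of_monic _ _ fun i _ => monic_X_sub_C _]
    simp
  ext j
  rw [coeff_C_mul]
  rcases lt_trichotomy j m with h | rfl | h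
  · have e := coeff_monicPoly_of_lt (critCoeff ζ k) (Fin.succ ⟨j, h⟩)
    simp only [Fin.val_succ] at e
    rw [coeff_derivative, e, critCoeff, Fin.cons_succ]
    have : (j : ℂ) + 1 ≠ 0 := Nat.cast_add_one_ne_zero j
    field_simp
  · rw [coeff_derivative_monicPoly_top]
    have : (∏ i, (X - C (ζ i))).coeff j = 1 := by
      have := hm.coeff_natDegree
      rwa [hd] at this
    rw [this, mul_one]
  · rw [coeff_eq_zero_of_natDegree_lt, coeff_eq_zero_of_natDegree_lt (by rwa [hd]), mul_zero]
    rwa [natDegree_derivative_monicPoly]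

/-- The derivative splits over ℂ, and a polynomial is determined by its derivative and its constant
term. -/
theorem exists_critCoeff (a : Fin (m + 1) → ℂ) : ∃ ζ : Fin m → ℂ, critCoeff ζ (a 0) = a := by
  have hs := IsAlgClosed.splits (derivative (monicPoly a))
  obtain ⟨l, hl⟩ := Quotient.exists_rep (derivative (monicPoly a)).roots
  have hlen : l.length = m := by
    have h := hs.natDegree_eq_card_roots
    rw [natDegree_derivative_monicPoly] at h
    rw [h, ← hl]
    rfl
  have hprod := hs.eq_prod_roots
  rw [leadingCoeff_derivative_monicPoly, ← hl] at hprod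
  subst hlen
  refine ⟨l.get, ?_⟩
  have e : derivative (monicPoly (critCoeff l.get (a 0))) = derivative (monicPoly a) := by
    rw [derivative_critCoeff, hprod]
    congr 1
    simp only [Multiset.quot_mk_to_coe, Multiset.map_coe, Multiset.prod_coe]
    rw [← List.prod_ofFn]
    congr 1
    conv_rhs => rw [← List.ofFn_get l, List.map_ofFn]
    rfl
  funext i
  refine Fin.cases rfl (fun j => ?_) i
  have := congrArg (fun p => p.coeff j) e
  simp only [coeff_derivative] at this
  have h1 := coeff_monicPoly_of_lt (critCoeff l.get (a 0)) j.succ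
  have h2 := coeff_monicPoly_of_lt a j.succ
  rw [Fin.val_succ] at h1 h2
  rw [h1, h2] at this
  exact mul_right_cancel₀ (Nat.cast_add_one_ne_zero _) this

theorem branchLocus_critCoeff (ζ : Fin m → ℂ) (k : ℂ) :
    branchLocus (monicPoly (critCoeff ζ k)) =
      Set.range fun i => (monicPoly (critCoeff ζ k)).eval (ζ i) := by
  have hm : (m : ℂ) + 1 ≠ 0 := Nat.cast_add_one_ne_zero m
  ext w
  simp only [branchLocus, derivative_critCoeff, eval_mul, eval_C, eval_prod, eval_sub, eval_X,
    mul_eq_zero, hm, false_or, Finset.prod_eq_zero_iff, Finset.mem_univ, true_and, Set.mem_image,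
    Set.mem_ofPred_eq, Set.mem_range, sub_eq_zero]
  constructor
  · rintro ⟨z, ⟨i, rfl⟩, rfl⟩
    exact ⟨i, rfl⟩
  · rintro ⟨i, rfl⟩
    exact ⟨_, ⟨i, rfl⟩, rfl⟩

theorem continuous_coeff_prod {ι Y : Type*} [TopologicalSpace Y] (s : Finset ι) (f : ι → Y → ℂ)
    (hf : ∀ i, Continuous (f i)) (k : ℕ) :
    Continuous fun y => (∏ i ∈ s, (X - C (f i y))).coeff k := by
  classical
  induction s using Finset.induction_on generalizing k with
  | empty => simpa using continuous_const
  | insert i s hi ih =>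
    simp only [Finset.prod_insert hi, coeff_mul]
    refine continuous_finsetSum _ fun x _ => Continuous.mul ?_ (ih _)
    simp only [coeff_sub, coeff_C]
    split_ifs
    · exact continuous_const.sub (hf i)
    · exact continuous_const

theorem continuous_critCoeff :
    Continuous fun x : (Fin m → ℂ) × ℂ => critCoeff x.1 x.2 := by
  refine continuous_pi fun i => ?_
  refine Fin.cases ?_ (fun j => ?_) i
  · simpa [critCoeff] using continuous_snd
  · simp only [critCoeff, Fin.cons_succ]
    exact continuous_const.mul (continuous_coeff_prod _ _ (fun i => by fun_prop) _)

/-- Along a complex line of critical points and constant terms, each critical value is given by a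
polynomial. -/
theorem exists_eval_eq_criticalValue (ζ ζ' : Fin m → ℂ) (k k' : ℂ) (i : Fin m) :
    ∃ p : ℂ[X], ∀ c : ℂ, p.eval c = (monicPoly (critCoeff (ζ + c • ζ') (k + c • k'))).eval
      ((ζ + c • ζ') i) := by
  let Z (i : Fin m) : ℂ[X] := C (ζ i) + X * C (ζ' i)
  -- The product of the X - ζ_i(c) with c kept as an inner variable, so that its coefficients are
  -- polynomials in c.
  let G : ℂ[X][X] := ∏ i, (X - C (Z i))
  have hZ (c : ℂ) (i : Fin m) : (Z i).eval c = ζ i + c * ζ' i := by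
    simp [Z, mul_comm c]
  have hG (c : ℂ) (j : ℕ) :
      (G.coeff j).eval c = (∏ i, (X - C (ζ i + c * ζ' i))).coeff j := by
    have : G.map (evalRingHom c) = ∏ i, (X - C (ζ i + c * ζ' i)) := by
      simp only [G, Polynomial.map_prod, Polynomial.map_sub, map_X, map_C, coe_evalRingHom, hZ]
    rw [← this, coeff_map, coe_evalRingHom]
  refine ⟨Z i ^ (m + 1) + ∑ j : Fin (m + 1),
    (Fin.cons (C k + X * C k') (fun j : Fin m => C (((m : ℂ) + 1) / ((j : ℕ) + 1)) * G.coeff j) :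
      Fin (m + 1) → ℂ[X]) j * Z i ^ (j : ℕ), fun c => ?_⟩
  rw [eval_monicPoly, Fin.sum_univ_succ, Fin.sum_univ_succ]
  simp [eval_finsetSum, critCoeff, hZ, hG, mul_comm c]

/-- The arcs t + i e t (1 - t) with 0 < e < 1 are disjoint except at their ends: e is recovered as
im / (re (1 - re)). Each point of s thus excludes at most one of infinitely many e. -/
theorem exists_curve (s : Set ℂ) (hs : s.Finite) (h1 : (1 : ℂ) ∉ s) :
    ∃ c : C(I, ℂ), c 0 = 0 ∧ c 1 = 1 ∧ (∀ t, ‖c t‖ ≤ 2) ∧ ∀ t, t ≠ 0 → c t ∉ s := by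
  obtain ⟨e, he, hes⟩ := (Set.Ioo_infinite (zero_lt_one (α := ℝ))).exists_notMem_finite
    (hs.image fun z : ℂ => z.im / (z.re * (1 - z.re)))
  refine ⟨⟨fun t => (t : ℝ) + ((e * (t * (1 - t)) : ℝ) : ℂ) * Complex.I, by fun_prop⟩,
    by simp, by simp, fun t => ?_, fun t ht hts => ?_⟩
  · refine (norm_add_le _ _).trans ?_
    rw [norm_mul, Complex.norm_I, mul_one, Complex.norm_real, Complex.norm_real,
      Real.norm_of_nonneg t.2.1, Real.norm_of_nonneg]
    · nlinarith [t.2.1, t.2.2, he.1, he.2, mul_nonneg t.2.1 (sub_nonneg.2 t.2.2)]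
    · exact mul_nonneg he.1.le (mul_nonneg t.2.1 (sub_nonneg.2 t.2.2))
  · by_cases ht1 : t = 1
    · subst ht1
      exact h1 (by simpa using hts)
    · refine hes ⟨_, hts, ?_⟩
      have h2 : (t : ℝ) ≠ 0 := fun h => ht (Subtype.ext h)
      have h3 : 1 - (t : ℝ) ≠ 0 := sub_ne_zero.2 fun h => ht1 (Subtype.ext h.symm)
      simp
      field_simp

theorem norm_le_of_critCoeff {ζ : Fin m → ℂ} {k : ℂ} {r : ℝ} (h : ‖critCoeff ζ k‖ ≤ r) :
    ‖ζ‖ ≤ r + 1 := by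
  refine (pi_norm_le_iff_of_nonneg (by linarith [norm_nonneg (critCoeff ζ k)])).2 fun i => ?_
  refine norm_le_of_critical h ?_
  rw [derivative_critCoeff, eval_mul, eval_prod, Finset.prod_eq_zero (Finset.mem_univ i), mul_zero]
  simp

/-- Loops over a polynomial can be moved to a polynomial with the maximal number of critical
values. -/
theorem absorbs_of_ncard {a₀ : Fin (m + 1) → ℂ} (h₀ : (branchLocus (monicPoly a₀)).ncard = m)
    (r₀ : ℝ) (ha₀ : ‖a₀‖ ≤ r₀) : ∃ (r : ℝ) (M : ℂ)
    (hM : ∀ a ∈ Metric.closedBall (0 : Fin (m + 1) → ℂ) r, (a, M) ∈ regular m), r₀ ≤ r ∧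
      ∀ a, ‖a‖ ≤ r₀ → Absorbs hM a a₀ := by
  -- The curves below have critical points x + c (y - x) with ‖x‖, ‖y‖ ≤ r₀ + 1 and ‖c‖ ≤ 2, hence
  -- the factor 1 + 2 · 2 = 5; the constant terms obey the same bound. M has to be regular along all
  -- these curves, hence the larger radius max r₀ R.
  have hK := (isCompact_closedBall (0 : (Fin m → ℂ) × ℂ) (5 * (r₀ + 1))).image
    continuous_critCoeff
  obtain ⟨R, hR⟩ := hK.isBounded.exists_norm_le
  obtain ⟨M, hM⟩ := exists_mem_regular (m := m) (max r₀ R)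
  refine ⟨max r₀ R, M, hM, le_max_left _ _, fun a ha => ?_⟩
  obtain ⟨ζ, hζ⟩ := exists_critCoeff a
  obtain ⟨ζ₀, hζ₀⟩ := exists_critCoeff a₀
  choose p hp using exists_eval_eq_criticalValue ζ (ζ₀ - ζ) (a 0) (a₀ 0 - a 0)
  have hinj1 : Function.Injective fun i => (p i).eval 1 := by
    have e : branchLocus (monicPoly a₀) = Set.range fun i => (p i).eval 1 := by
      conv_lhs => rw [← hζ₀]
      rw [branchLocus_critCoeff]
      simp [hp, hζ₀]
    classical
    rw [e, ← Set.image_univ, ← Finset.coe_univ, ← Finset.coe_image, Set.ncard_coe_finset] at h₀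
    have := Finset.card_image_iff.1 (h₀.trans (Finset.card_fin m).symm)
    rwa [Finset.coe_univ, Set.injOn_univ] at this
  -- For i ≠ j the polynomial p i - p j does not vanish at c = 1, so it is nonzero and two critical
  -- values collide for finitely many c only.
  have hfin : {c | ¬ Function.Injective fun i => (p i).eval c}.Finite := by
    have : {c | ¬ Function.Injective fun i => (p i).eval c} ⊆
        ⋃ x : Fin m × Fin m, ⋃ _ : x.1 ≠ x.2, (p x.1 - p x.2).rootSet ℂ := by
      intro c hc
      simp only [Set.mem_ofPred_eq, Function.Injective, not_forall] at hc
      obtain ⟨i, j, hij, hne⟩ := hc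
      refine Set.mem_iUnion₂.2 ⟨(i, j), hne, mem_rootSet.2 ⟨fun h => hne (hinj1 ?_), ?_⟩⟩
      · simp only [sub_eq_zero.1 h]
      · simpa [sub_eq_zero] using hij
    exact (Set.finite_iUnion fun x => Set.finite_iUnion fun _ => rootSet_finite _ _).subset this
  obtain ⟨c, hc0, hc1, hc2, hcs⟩ := exists_curve _ hfin (by simpa using hinj1)
  have hcont : Continuous fun t : I => critCoeff (ζ + c t • (ζ₀ - ζ)) (a 0 + c t • (a₀ 0 - a 0)) :=
    continuous_critCoeff.comp
      (f := fun t : I => (ζ + c t • (ζ₀ - ζ), a 0 + c t • (a₀ 0 - a 0))) (by fun_prop)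
  have hn (t : I) {E : Type} [NormedAddCommGroup E] [NormedSpace ℂ E] (x y : E)
      (hx : ‖x‖ ≤ r₀ + 1) (hy : ‖y‖ ≤ r₀ + 1) : ‖x + c t • (y - x)‖ ≤ 5 * (r₀ + 1) := by
    refine (norm_add_le _ _).trans ?_
    rw [norm_smul]
    have h1 := norm_sub_le y x
    have h2 := mul_le_mul (hc2 t) (h1.trans (add_le_add hy hx)) (norm_nonneg _) zero_le_two
    linarith
  refine absorbs_of_injective (ι := Fin m) isOpen_regular (convex_closedBall _ _) hM
    ⟨⟨_, hcont⟩, by simp [hc0, hζ], by simp [hc1, hζ₀]⟩ (fun t => ?_)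
    (fun i => ⟨fun t => (p i).eval (c t), by fun_prop⟩) (fun t w => ?_) (fun t ht => ?_)
  · rw [mem_closedBall_zero_iff]
    refine (hR _ ⟨(_, _), ?_, rfl⟩).trans (le_max_right _ _)
    rw [mem_closedBall_zero_iff, Prod.norm_def]
    refine max_le (hn t _ _ (norm_le_of_critCoeff (hζ ▸ ha)) (norm_le_of_critCoeff (hζ₀ ▸ ha₀)))
      (hn t _ _ ?_ ?_)
    · exact (norm_le_pi_norm a 0).trans (by linarith)
    · exact (norm_le_pi_norm a₀ 0).trans (by linarith)
  · simp only [regular, Set.mem_ofPred_eq, Path.coe_mk_mk, branchLocus_critCoeff, Set.mem_range,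
      not_exists, ContinuousMap.coe_mk, hp]
    exact forall_congr' fun i => ne_comm
  · exact not_not.1 (hcs t ht)

/-- Over a polynomial of degree `m + 1` with `m` critical values, the fibre carries the whole
fundamental group of the space of regular pairs. -/
theorem exists_vert_eq_of_ncard {a₀ : Fin (m + 1) → ℂ}
    (h₀ : (branchLocus (monicPoly a₀)).ncard = m) {u₀ : ℂ} {hu₀ : (a₀, u₀) ∈ regular m}
    (q : Path (⟨(a₀, u₀), hu₀⟩ : regular m) ⟨(a₀, u₀), hu₀⟩) :
    ∃ (l : Path u₀ u₀) (hl : ∀ t, (a₀, l t) ∈ regular m),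
      Path.Homotopic.Quotient.mk q = vert a₀ l hl := by
  have hc : Continuous fun t => (q t).1.1 := by fun_prop
  obtain ⟨r₀, hr₀⟩ := (isCompact_range hc).isBounded.exists_norm_le
  have hq (t) : ‖(q t).1.1‖ ≤ r₀ := hr₀ _ ⟨t, rfl⟩
  obtain ⟨r, M, hM, hr, habs⟩ := absorbs_of_ncard h₀ r₀ (by simpa using hq 0)
  exact exists_vert_eq isOpen_regular (convex_closedBall _ _)
    (Metric.closedBall_subset_closedBall hr) exists_path_regular
    (fun a ha => habs a (mem_closedBall_zero_iff.1 ha)) q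
    fun t => mem_closedBall_zero_iff.2 (hq t)

end

/-! ### The covering by roots -/

section

variable {m : ℕ}

/-- Inverse function theorem: the derivative at (a, z) is the identity on coefficients and
multiplication by p_a'(z) ≠ 0 in the direction of z, hence injective and, in finite dimension,
invertible. -/
theorem isLocalHomeomorphOn_evalMap :
    IsLocalHomeomorphOn (evalMap (m := m)) (evalMap ⁻¹' regular m) := by
  rintro ⟨a, z⟩ hx
  have hz : (derivative (monicPoly a)).eval z ≠ 0 := fun h => hx ⟨z, h, rfl⟩
  have hcd : ContDiff ℂ 1 (fun x : (Fin (m + 1) → ℂ) × ℂ => (monicPoly x.1).eval x.2) := by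
    simp only [eval_monicPoly]
    fun_prop
  have hcd' : ContDiff ℂ 1 (evalMap (m := m)) := contDiff_fst.prodMk hcd
  obtain ⟨L, hL⟩ : ∃ L, HasFDerivAt (fun x : (Fin (m + 1) → ℂ) × ℂ => (monicPoly x.1).eval x.2) L
      (a, z) := ⟨_, (hcd.differentiable one_ne_zero (a, z)).hasFDerivAt⟩
  have hL1 (u : ℂ) : L (0, u) = u * (derivative (monicPoly a)).eval z := by
    have h1 : HasDerivAt (fun w : ℂ => ((a, w) : (Fin (m + 1) → ℂ) × ℂ)) (0, 1) z :=
      (hasDerivAt_const z a).prodMk (hasDerivAt_id z)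
    have h2 := (hL.comp_hasDerivAt z h1).unique ((monicPoly a).hasDerivAt z)
    rw [← h2, ← smul_eq_mul, ← map_smul]
    simp
  have hD : HasFDerivAt (evalMap (m := m)) ((ContinuousLinearMap.fst ℂ _ _).prod L) (a, z) :=
    hasFDerivAt_fst.prodMk hL
  have hinj : Function.Injective ((ContinuousLinearMap.fst ℂ (Fin (m + 1) → ℂ) ℂ).prod L :
      (Fin (m + 1) → ℂ) × ℂ →ₗ[ℂ] (Fin (m + 1) → ℂ) × ℂ) := by
    refine (injective_iff_map_eq_zero _).2 ?_
    rintro ⟨v, u⟩ h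
    obtain ⟨h1, h2⟩ := Prod.ext_iff.1 h
    have h1' : v = 0 := h1
    subst h1'
    have h2' : L (0, u) = 0 := h2
    rw [hL1] at h2'
    rw [(mul_eq_zero.1 h2').resolve_right hz]
    rfl
  let e := (LinearEquiv.ofInjectiveEndo _ hinj).toContinuousLinearEquiv
  have hD' : HasFDerivAt (evalMap (m := m)) (e : _ →L[ℂ] _) (a, z) := by
    have h : (e : _ →L[ℂ] _) = (ContinuousLinearMap.fst ℂ _ _).prod L :=
      ContinuousLinearMap.ext fun _ => rfl
    rwa [h]
  exact ⟨hcd'.contDiffAt.toOpenPartialHomeomorph _ hD' one_ne_zero,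
    hcd'.contDiffAt.mem_toOpenPartialHomeomorph_source hD' one_ne_zero, rfl⟩

/-- A closed local homeomorphism with finite fibres is a covering. -/
theorem isCoveringMapOn_evalMap : IsCoveringMapOn (evalMap (m := m)) (regular m) := by
  refine isProperMap_evalMap.isClosedMap.isCoveringMapOn_of_isLocalHomeomorphOn (fun x _ => ?_)
    isLocalHomeomorphOn_evalMap
  have hne : monicPoly x.1 - C x.2 ≠ 0 := by
    intro h
    have := congrArg derivative h
    rw [derivative_sub, derivative_C, sub_zero, derivative_zero] at this
    exact derivative_monicPoly_ne_zero _ this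
  refine ((rootSet_finite (monicPoly x.1 - C x.2) ℂ).image (Prod.mk x.1)).subset ?_
  rintro ⟨a, z⟩ rfl
  exact ⟨z, by simp [mem_rootSet, evalMap] at hne ⊢; exact hne, rfl⟩

/-- The covering of the space of regular pairs by the roots. -/
def rootCover (m : ℕ) : evalMap ⁻¹' regular m → regular m := (regular m).restrictPreimage evalMap

theorem isCoveringMap_rootCover : IsCoveringMap (rootCover m) :=
  isCoveringMapOn_evalMap.isCoveringMap_restrictPreimage

end

/-! ### Braids as loops of polynomials -/

section

variable {m : ℕ}

/-- Uniqueness of lifts: two lifts of g that meet once agree everywhere. This makes a lifted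
homotopy an isotopy of braids. -/
theorem injective_rootLifts {ι A : Type*} [TopologicalSpace A] [PreconnectedSpace A]
    (G : ι → C(A, evalMap ⁻¹' regular m)) {g : A → regular m}
    (hg : ∀ q a, rootCover m (G q a) = g a) (a₀ : A) (h₀ : Function.Injective fun q => G q a₀)
    (a : A) : Function.Injective fun q => (G q a).1.2 := by
  intro q q' h
  have h1 : (G q : A → _) = G q' := by
    refine isCoveringMap_rootCover.eq_of_comp_eq (G q).continuous (G q').continuous
      (funext fun a => (hg q a).trans (hg q' a).symm) a (Subtype.ext (Prod.ext ?_ h))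
    have := congrArg (fun x : regular m => x.1.1) ((hg q a).trans (hg q' a).symm)
    exact this
  exact h₀ (congrFun h1 a₀)

variable {a₀ : Fin (m + 1) → ℂ} {w₀ : ((branchLocus (monicPoly a₀))ᶜ : Set ℂ)}

theorem card_fiber_monicPoly [Fintype (fiber (monicPoly a₀) w₀)] :
    Fintype.card (fiber (monicPoly a₀) w₀) = m + 1 := by
  have h := ncard_fiber (monicPoly a₀) (by rw [natDegree_monicPoly]; exact Nat.succ_pos m) w₀.2
  rw [natDegree_monicPoly, ← Nat.card_coe_set_eq, Nat.card_eq_fintype_card] at h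
  exact h

instance : Finite (fiber (monicPoly a₀) w₀) := by
  refine Set.finite_of_ncard_ne_zero ?_
  rw [ncard_fiber _ (by rw [natDegree_monicPoly]; exact Nat.succ_pos m) w₀.2, natDegree_monicPoly]
  exact Nat.succ_ne_zero m

instance : Fintype (fiber (monicPoly a₀) w₀) := Fintype.ofFinite _

/-- The monic polynomial that takes the value `w₀` at the points `f q`. -/
def labelPoly (w₀ : ((branchLocus (monicPoly a₀))ᶜ : Set ℂ)) (f : Conf (fiber (monicPoly a₀) w₀)) :
    ℂ[X] :=
  ∏ q, (X - C (f.1 q)) + C (w₀ : ℂ)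

theorem monic_natDegree_labelPoly (f : Conf (fiber (monicPoly a₀) w₀)) :
    (labelPoly w₀ f).Monic ∧ (labelPoly w₀ f).natDegree = m + 1 := by
  have hm : (∏ q, (X - C (f.1 q))).Monic := monic_prod_of_monic _ _ fun i _ => monic_X_sub_C _
  have hd : (∏ q, (X - C (f.1 q))).natDegree = m + 1 := by
    rw [natDegree_prod_of_monic _ _ fun i _ => monic_X_sub_C _]
    simp only [natDegree_X_sub_C, Finset.sum_const, Finset.card_univ, card_fiber_monicPoly,
      smul_eq_mul, mul_one]
  refine ⟨hm.add_of_left ?_, ?_⟩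
  · refine degree_C_le.trans_lt ?_
    rw [← natDegree_pos_iff_degree_pos, hd]
    exact Nat.succ_pos m
  · rw [labelPoly, natDegree_add_C, hd]

theorem eval_labelPoly (f : Conf (fiber (monicPoly a₀) w₀)) (z : ℂ) :
    (labelPoly w₀ f).eval z = w₀ ↔ ∃ q, z = f.1 q := by
  simp [labelPoly, eval_prod, Finset.prod_eq_zero_iff, sub_eq_zero]

theorem notMem_branchLocus_labelPoly (f : Conf (fiber (monicPoly a₀) w₀)) :
    (w₀ : ℂ) ∉ branchLocus (labelPoly w₀ f) := by
  rintro ⟨z, hz, e⟩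
  have hsep : (∏ q, (X - C (f.1 q))).Separable := separable_prod_X_sub_C_iff.2 f.2
  have h0 : (∏ q, (X - C (f.1 q))).eval z = 0 := by simpa [labelPoly] using e
  refine hsep.aeval_derivative_ne_zero (x := z) (by rwa [coe_aeval_eq_eval]) ?_
  simpa [labelPoly] using hz

/-- Both polynomials are monic of degree m + 1 and equal w₀ on the m + 1 points of the fibre, so
their difference has too many zeros. The order of the roots does not matter, which is why a braid
gives a closed loop of polynomials. -/
theorem labelPoly_pt (τ : Equiv.Perm (fiber (monicPoly a₀) w₀)) :
    labelPoly w₀ (pt τ) = monicPoly a₀ := by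
  obtain ⟨hm, hd⟩ := monic_natDegree_labelPoly (pt τ)
  have hdeg : (labelPoly w₀ (pt τ)).degree = (m + 1 : ℕ) := by
    rw [degree_eq_natDegree hm.ne_zero, hd]
  have hdeg' : (monicPoly a₀).degree = (m + 1 : ℕ) := by
    rw [degree_eq_natDegree (monic_monicPoly a₀).ne_zero, natDegree_monicPoly]
  refine eq_of_degree_sub_lt_of_eval_finset_eq (fiber (monicPoly a₀) w₀).toFinset ?_ ?_
  · rw [Set.toFinset_card, card_fiber_monicPoly, ← hdeg]
    exact degree_sub_lt_left (hdeg.trans hdeg'.symm) hm.ne_zero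
      (hm.leadingCoeff.trans (monic_monicPoly a₀).leadingCoeff.symm)
  · intro z hz
    have hz' : (monicPoly a₀).eval z = w₀ := (Set.mem_toFinset (s := fiber _ _)).1 hz
    rw [hz', eval_labelPoly]
    exact ⟨τ.symm ⟨z, hz'⟩, by simp [pt]⟩

/-- The lower coefficients of `labelPoly`. -/
def labelCoeff (w₀ : ((branchLocus (monicPoly a₀))ᶜ : Set ℂ))
    (f : Conf (fiber (monicPoly a₀) w₀)) (i : Fin (m + 1)) : ℂ :=
  (labelPoly w₀ f).coeff i

theorem monicPoly_labelCoeff (f : Conf (fiber (monicPoly a₀) w₀)) :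
    monicPoly (labelCoeff w₀ f) = labelPoly w₀ f :=
  monicPoly_coeff (monic_natDegree_labelPoly f).1 (monic_natDegree_labelPoly f).2

theorem labelCoeff_pt (τ : Equiv.Perm (fiber (monicPoly a₀) w₀)) : labelCoeff w₀ (pt τ) = a₀ := by
  funext i
  rw [labelCoeff, labelPoly_pt, coeff_monicPoly_of_lt]

theorem continuous_labelCoeff : Continuous (labelCoeff w₀) := by
  refine continuous_pi fun i => ?_
  simp only [labelCoeff, labelPoly, coeff_add]
  exact (continuous_coeff_prod _ _ (fun q => (continuous_apply q).comp continuous_subtype_val) _).add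
    continuous_const

theorem labelCoeff_mem_regular (f : Conf (fiber (monicPoly a₀) w₀)) :
    (labelCoeff w₀ f, (w₀ : ℂ)) ∈ regular m := by
  rw [regular, Set.mem_ofPred_eq, monicPoly_labelCoeff]
  exact notMem_branchLocus_labelPoly f

theorem evalMap_labelCoeff (f : Conf (fiber (monicPoly a₀) w₀)) (q : fiber (monicPoly a₀) w₀) :
    evalMap (labelCoeff w₀ f, f.1 q) = (labelCoeff w₀ f, (w₀ : ℂ)) := by
  refine Prod.ext rfl ?_
  change (monicPoly (labelCoeff w₀ f)).eval (f.1 q) = w₀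
  rw [monicPoly_labelCoeff, eval_labelPoly]
  exact ⟨q, rfl⟩

theorem mem_preimage_regular (f : Conf (fiber (monicPoly a₀) w₀)) (q : fiber (monicPoly a₀) w₀) :
    (labelCoeff w₀ f, f.1 q) ∈ evalMap ⁻¹' regular m := by
  rw [Set.mem_preimage, evalMap_labelCoeff]
  exact labelCoeff_mem_regular _

/-- The loop of polynomials whose roots are the strands of a geometric braid. -/
def labelLoop {τ : Equiv.Perm (fiber (monicPoly a₀) w₀)}
    (b : Path (pt (1 : Equiv.Perm (fiber (monicPoly a₀) w₀))) (pt τ)) :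
    Path (⟨(a₀, w₀), w₀.2⟩ : regular m) ⟨(a₀, w₀), w₀.2⟩ where
  toFun t := ⟨(labelCoeff w₀ (b t), w₀), labelCoeff_mem_regular _⟩
  continuous_toFun := Continuous.subtype_mk
    ((continuous_labelCoeff.comp b.continuous).prodMk continuous_const) _
  source' := Subtype.ext (Prod.ext (by simp [labelCoeff_pt]) rfl)
  target' := Subtype.ext (Prod.ext (by simp [labelCoeff_pt]) rfl)

/-- The strands of a braid, as lifts of the loop of polynomials. -/
def labelStrand {τ : Equiv.Perm (fiber (monicPoly a₀) w₀)}
    (b : Path (pt (1 : Equiv.Perm (fiber (monicPoly a₀) w₀))) (pt τ))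
    (q : fiber (monicPoly a₀) w₀) : C(I, evalMap ⁻¹' regular m) where
  toFun t := ⟨(labelCoeff w₀ (b t), (b t).1 q), mem_preimage_regular _ _⟩
  continuous_toFun := Continuous.subtype_mk ((continuous_labelCoeff.comp b.continuous).prodMk
    ((continuous_apply q).comp (continuous_subtype_val.comp b.continuous))) _

theorem rootCover_labelStrand {τ : Equiv.Perm (fiber (monicPoly a₀) w₀)}
    (b : Path (pt (1 : Equiv.Perm (fiber (monicPoly a₀) w₀))) (pt τ))
    (q : fiber (monicPoly a₀) w₀) (t : I) : rootCover m (labelStrand b q t) = labelLoop b t :=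
  Subtype.ext (evalMap_labelCoeff _ _)

/-- The strands of the braid of a loop of values, as lifts to the covering by roots. -/
def valueStrand (γ : Path w₀ w₀) (q : fiber (monicPoly a₀) w₀) : C(I, evalMap ⁻¹' regular m) where
  toFun t := ⟨(a₀, strand γ q t), (strand γ q t).2⟩
  continuous_toFun := Continuous.subtype_mk
    (continuous_const.prodMk (continuous_subtype_val.comp (strand γ q).continuous)) _

/-- A braid is the braid of a loop of values if the corresponding loops of polynomials are
homotopic. -/
theorem mk'_eq_of_labelLoop_homotopic {τ : Equiv.Perm (fiber (monicPoly a₀) w₀)}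
    (b : Path (pt (1 : Equiv.Perm (fiber (monicPoly a₀) w₀))) (pt τ)) (γ : Path w₀ w₀)
    (h : (labelLoop b).Homotopic (pairPath (.refl a₀) (γ.map continuous_subtype_val)
      fun t => (γ t).2)) :
    BraidGroup.mk' (liftPerm (.mk γ)) (liftBraid γ) = BraidGroup.mk' τ b := by
  obtain ⟨F⟩ := h
  have hl (q : fiber (monicPoly a₀) w₀) :
      rootCover m ∘ labelStrand b q = (labelLoop b).toContinuousMap :=
    funext fun t => rootCover_labelStrand b q t
  have hl' (q : fiber (monicPoly a₀) w₀) : rootCover m ∘ valueStrand γ q =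
      (pairPath (O := regular m) (.refl a₀) (γ.map continuous_subtype_val)
        fun t => (γ t).2).toContinuousMap :=
    funext fun t => Subtype.ext (Prod.ext rfl (eval_strand γ q t))
  have hs (q : fiber (monicPoly a₀) w₀) : labelStrand b q 0 = valueStrand γ q 0 := by
    refine Subtype.ext (Prod.ext ?_ ?_)
    · change labelCoeff w₀ (b 0) = a₀
      rw [b.source, labelCoeff_pt]
    · change (b 0).1 q = strand γ q 0
      rw [b.source, strand_zero]
      rfl
  have hF (q : fiber (monicPoly a₀) w₀) (t : I) :
      F.toContinuousMap (0, t) = rootCover m (labelStrand b q t) :=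
    (F.apply_zero t).trans (rootCover_labelStrand b q t).symm
  let H (q : fiber (monicPoly a₀) w₀) : (labelStrand b q).HomotopyRel (valueStrand γ q) {0, 1} :=
    isCoveringMap_rootCover.liftHomotopyRel F ⟨0, .inl rfl, hs q⟩ (hl q) (hl' q)
  have hH (q : fiber (monicPoly a₀) w₀) (x : I × I) : rootCover m (H q x) = F x :=
    congrFun (isCoveringMap_rootCover.liftHomotopy_lifts F.toContinuousMap (labelStrand b q)
      (hF q)) x
  -- The lifted homotopy fixes end points, so both braids induce the same permutation.
  have hend (q : fiber (monicPoly a₀) w₀) : labelStrand b q 1 = valueStrand γ q 1 :=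
    ((H q).eq_fst 1 (by simp)).symm.trans ((H q).apply_one 1)
  have hperm : τ = liftPerm (.mk γ) := by
    refine Equiv.ext fun q => Subtype.ext ?_
    have h1 : (b 1).1 q = strand γ q 1 := congrArg (fun x => x.1.2) (hend q)
    rw [b.target] at h1
    rw [liftPerm_mk]
    exact h1
  refine (BraidGroup.mk'_eq hperm ?_).symm
  -- The lifts start at distinct points of the fibre, so the strands stay disjoint throughout the
  -- homotopy.
  have hinj : Function.Injective fun q => (H q) (0, 0) := by
    intro q q' h
    have h' : H q (0, 0) = H q' (0, 0) := h
    rw [(H q).apply_zero, (H q').apply_zero] at h'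
    have h1 : (b 0).1 q = (b 0).1 q' := congrArg (fun x => x.1.2) h'
    exact (b 0).2 h1
  refine ⟨{
    toFun := fun x => ⟨fun q => (H q x).1.2,
      injective_rootLifts (fun q => (H q).toContinuousMap) hH (0, 0) hinj x⟩
    continuous_toFun := Continuous.subtype_mk (continuous_pi fun q =>
      continuous_snd.comp (continuous_subtype_val.comp (H q).continuous)) _
    map_zero_left := fun t => Subtype.ext (funext fun q =>
      congrArg (fun x => x.1.2) ((H q).apply_zero t))
    map_one_left := fun t => Subtype.ext (funext fun q =>
      congrArg (fun x => x.1.2) ((H q).apply_one t))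
    prop' := fun s t ht => Subtype.ext (funext fun q =>
      congrArg (fun x => x.1.2) ((H q).eq_fst s ht)) }⟩

theorem surjective_braidMonodromy_monicPoly (h₀ : (branchLocus (monicPoly a₀)).ncard = m) :
    Function.Surjective (braidMonodromy (monicPoly a₀) w₀) := by
  intro x
  induction x using BraidGroup.ind' with | h τ b
  obtain ⟨l, hl, e⟩ := exists_vert_eq_of_ncard h₀ (labelLoop b)
  -- The vertical loop l over a₀ avoids the critical values, so it is a loop in the complement of
  -- the branch locus.
  let γ : Path w₀ w₀ :=
    ⟨⟨fun t => ⟨l t, hl t⟩, by fun_prop⟩, Subtype.ext l.source, Subtype.ext l.target⟩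
  refine ⟨.op (Path.Homotopic.Quotient.mk γ), ?_⟩
  exact mk'_eq_of_labelLoop_homotopic b γ (Path.Homotopic.Quotient.eq.1 e)

end

end BraidMonodromy

end

theorem theorem0p1 (n : ℕ) (hn : 1 < n) (P : Polynomial ℂ) (hP : P.Monic)
    (hdeg : P.natDegree = n) (hB : (BraidMonodromy.branchLocus P).ncard = n - 1)
    (w₀ : ((BraidMonodromy.branchLocus P)ᶜ : Set ℂ)) :
    Function.Surjective (BraidMonodromy.braidMonodromy P w₀) ∧
      BraidMonodromy.braidMonodromyGroup P w₀ = ⊤ := by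
  obtain ⟨m, rfl⟩ : ∃ m, n = m + 1 := ⟨n - 1, by omega⟩
  obtain ⟨a₀, rfl⟩ : ∃ a₀ : Fin (m + 1) → ℂ, BraidMonodromy.monicPoly a₀ = P :=
    ⟨_, BraidMonodromy.monicPoly_coeff hP hdeg⟩
  have h := BraidMonodromy.surjective_braidMonodromy_monicPoly (w₀ := w₀) hB
  exact ⟨h, MonoidHom.range_eq_top.2 h⟩
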